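/- Let $N\in\mathbb N$. A \emph{weight function} is a continuous increasing (i.e. nondecreasing) function $\omega:[0,\infty)\to[0,\infty)$ such that: ($\alpha$) there is $K\ge 1$ with $\omega(2x)\le K(1+\omega(x))$ for all $x\ge 0$; ($\beta$) $\omega(x)=o(x)$ as $x\to\infty$; ($\gamma$) there are $a\in\mathbb R$, $b>0$ with $\omega(x)\ge a+b\log(1+x)$ for all $x\ge0$; ($\delta$) $x\mapsto\omega(e^x)$ is convex on $\mathbb R$. Let $\omega_1,\dots,\omega_N,\sigma_1,\dots,\sigma_N$ be weight functions and put $\Omega(x)=\sum_{j=1}^N\omega_j(|x_j|)$, $\Sigma(x)=\sum_{j=1}^N\sigma_j(|x_j|)$ for $x\in\mathbb R^N$. With $\hat f(\xi)=\int_{\mathbb R^N}e^{-ix\cdot\xi}f(x)\,dx$ and $D_j=-i\partial_j$, let $\mathcal S_\Omega^\Sigma(\mathbb R^N)$ be the space of all $f\in L^1(\mathbb R^N)$ such that $f,\hat f\in C^\infty(\mathbb R^N)$ and $$\|e^{\lambda\Omega}D^\alpha f\|_\infty<\infty,\qquad \|e^{\lambda\Sigma}D^\alpha\hat f\|_\infty<\infty\qquad\text{for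 all }\lambda>0,\ \alpha\in\mathbb N_0^N,$$ with the Fréchet topology given by the seminorms $\|e^{n\Omega}D^\alpha f\|_\infty$ and $\|e^{n\Sigma}D^\alpha\hat f\|_\infty$ ($n\in\mathbb N$, $n\geq 1$, $\alpha\in\mathbb N_0^N$). Let $(\mathcal S_\Omega^\Sigma)'(\mathbb R^N)$ be the space of continuous linear maps $\mathcal S_\Omega^\Sigma(\mathbb R^N)\to\mathbb C$; a function $h\in\mathcal S_\Omega^\Sigma(\mathbb R^N)$ is identified with the functional $\varphi\mapsto\int_{\mathbb R^N} h(t)\varphi(t)\,dt$. For $g\in\mathcal S_\Omega^\Sigma(\mathbb R^N)$ and $f\in(\mathcal S_\Omega^\Sigma)'(\mathbb R^N)$ the short-time Fourier transform is $$V_gf(x,\xi)=\big\langle f,\ e^{-i\,t\cdot\xi}\,\overline{g(t-x)}\big\rangle_t,\qquad x,\xi\in\mathbb R^N .$$ \textbf{Theorem.} Let $g\in\mathcal S_\Omega^\Sigma(\mathbb R^N)$, $g\ne0$, and let $f\in(\mathcal S_\Omega^\Sigma)'(\mathbb R^N)$. The following conditions are equivalent: (1) $f\in\mathcal S_\Omega^\Sigma(\mathbb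 R^N)$; (2) for every $\lambda>0$ there is a constant $C_\lambda>0$ such that $$|V_gf(x,\xi)|\le C_\lambda\,e^{-\lambda(\Omega(x)+\Sigma(\xi))}\qquad\text{for all }x,\xi\in\mathbb R^N .$$ -/

import Mathlib

noncomputable section

namespace Beurling

/-- Weight functions. A weight is a function on `[0, ∞)`; here it is a function on `ℝ` of which only
the values on `[0, ∞)` are constrained (and used). -/
structure WeightFunction where
  toFun : ℝ → ℝ
  continuousOn : ContinuousOn toFun (Set.Ici 0)
  monotoneOn : MonotoneOn toFun (Set.Ici 0)
  nonneg : ∀ x, 0 ≤ x → 0 ≤ toFun x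
  /-- condition (α) -/
  doubling : ∃ K : ℝ, 1 ≤ K ∧ ∀ x, 0 ≤ x → toFun (2 * x) ≤ K * (1 + toFun x)
  /-- condition (β) -/
  isLittleO : toFun =o[Filter.atTop] (fun x : ℝ => x)
  /-- condition (γ) -/
  log_le : ∃ a b : ℝ, 0 < b ∧ ∀ x, 0 ≤ x → a + b * Real.log (1 + x) ≤ toFun x
  /-- condition (δ) -/
  convexOn_comp_exp : ConvexOn ℝ Set.univ (fun x : ℝ => toFun (Real.exp x))

variable {N : ℕ}

/-- The function `(ω₁ ⊕ ⋯ ⊕ ω_N)(x) = ω₁(|x₁|) + ⋯ + ω_N(|x_N|)` on `ℝ^N`. -/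
def directSum (ω : Fin N → WeightFunction) (x : EuclideanSpace ℝ (Fin N)) : ℝ :=
  ∑ j, (ω j).toFun |x j|

/-- `D_j = -i ∂_j`. -/
def pderiv (j : Fin N) (f : EuclideanSpace ℝ (Fin N) → ℂ) : EuclideanSpace ℝ (Fin N) → ℂ :=
  fun x => -Complex.I * fderiv ℝ f x (EuclideanSpace.single j 1)

/-- `D^α = D_1^{α_1} ⋯ D_N^{α_N}`. -/
def mderiv (α : Fin N → ℕ) (f : EuclideanSpace ℝ (Fin N) → ℂ) : EuclideanSpace ℝ (Fin N) → ℂ :=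
  (List.finRange N).foldr (fun j h => (pderiv j)^[α j] h) f

/-- The Fourier transform `f̂(ξ) = ∫ exp(-i x·ξ) f(x) dx`. -/
def fourierT (f : EuclideanSpace ℝ (Fin N) → ℂ) (ξ : EuclideanSpace ℝ (Fin N)) : ℂ :=
  ∫ x, Complex.exp (-(Complex.I * (inner ℝ x ξ : ℝ))) * f x

/-- `f ∈ C^∞(ℝ^N)` and `‖exp(lΩ) D^α f‖_∞ < ∞` for all `l > 0` and all multi-indices `α`. -/
def WeightedSmooth (Ω : EuclideanSpace ℝ (Fin N) → ℝ) (f : EuclideanSpace ℝ (Fin N) → ℂ) : Prop :=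
  ContDiff ℝ (⊤ : ℕ∞) f ∧
    ∀ l : ℝ, 0 < l → ∀ α : Fin N → ℕ, ∃ C : ℝ, ∀ x, Real.exp (l * Ω x) * ‖mderiv α f x‖ ≤ C

/-! ### Linearity and smoothness of the operators -/

lemma contDiff_pderiv (j : Fin N) {f : EuclideanSpace ℝ (Fin N) → ℂ} (hf : ContDiff ℝ (⊤ : ℕ∞) f) :
    ContDiff ℝ (⊤ : ℕ∞) (pderiv j f) := by
  have h : ContDiff ℝ (⊤ : ℕ∞) (fderiv ℝ f) := hf.fderiv_right (by simp)
  exact contDiff_const.mul (h.clm_apply contDiff_const)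

lemma pderiv_add (j : Fin N) {f g : EuclideanSpace ℝ (Fin N) → ℂ} (hf : ContDiff ℝ (⊤ : ℕ∞) f)
    (hg : ContDiff ℝ (⊤ : ℕ∞) g) : pderiv j (f + g) = pderiv j f + pderiv j g := by
  funext x
  have h1 := (hf.differentiable (by simp)) x
  have h2 := (hg.differentiable (by simp)) x
  simp only [pderiv, fderiv_add h1 h2, Pi.add_apply, add_apply]
  ring

lemma pderiv_smul (j : Fin N) (c : ℂ) {f : EuclideanSpace ℝ (Fin N) → ℂ} (hf : ContDiff ℝ (⊤ : ℕ∞) f) :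
    pderiv j (c • f) = c • pderiv j f := by
  funext x
  have h1 := (hf.differentiable (by simp)) x
  simp only [pderiv, fderiv_const_smul h1, Pi.smul_apply, smul_apply,
    smul_eq_mul]
  ring

/-- A set of functions stable under all `D_j` is stable under all `D^α`. -/
lemma mderiv_mem {T : Set (EuclideanSpace ℝ (Fin N) → ℂ)}
    (hT : ∀ j, ∀ f ∈ T, pderiv j f ∈ T) (α : Fin N → ℕ) {f : EuclideanSpace ℝ (Fin N) → ℂ}
    (hf : f ∈ T) : mderiv α f ∈ T := by
  have key : ∀ l : List (Fin N), l.foldr (fun j h => (pderiv j)^[α j] h) f ∈ T := by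
    intro l
    induction l with
    | nil => exact hf
    | cons j t ih =>
      have : ∀ n : ℕ, ∀ h ∈ T, (pderiv j)^[n] h ∈ T := by
        intro n
        induction n with
        | zero => intro h hh; exact hh
        | succ n ihn => intro h hh; exact ihn _ (hT j h hh)
      exact this _ _ ih
  exact key _

/-- An identity between smooth functions that is preserved by all `D_j` is preserved by `D^α`. -/
lemma mderiv_rel {R : (EuclideanSpace ℝ (Fin N) → ℂ) → (EuclideanSpace ℝ (Fin N) → ℂ) →
      (EuclideanSpace ℝ (Fin N) → ℂ) → Prop}
    (hR : ∀ j f g h, R f g h → R (pderiv j f) (pderiv j g) (pderiv j h)) (α : Fin N → ℕ)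
    {f g h : EuclideanSpace ℝ (Fin N) → ℂ} (H : R f g h) :
    R (mderiv α f) (mderiv α g) (mderiv α h) := by
  have key : ∀ l : List (Fin N), R (l.foldr (fun j h => (pderiv j)^[α j] h) f)
      (l.foldr (fun j h => (pderiv j)^[α j] h) g) (l.foldr (fun j h => (pderiv j)^[α j] h) h) := by
    intro l
    induction l with
    | nil => exact H
    | cons j t ih =>
      have : ∀ n : ℕ, ∀ f g h, R f g h →
          R ((pderiv j)^[n] f) ((pderiv j)^[n] g) ((pderiv j)^[n] h) := by
        intro n
        induction n with
        | zero => intro f g h hh; exact hh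
        | succ n ihn => intro f g h hh; exact ihn _ _ _ (hR j _ _ _ hh)
      exact this _ _ _ _ ih
  exact key _

lemma mderiv_add (α : Fin N → ℕ) {f g : EuclideanSpace ℝ (Fin N) → ℂ} (hf : ContDiff ℝ (⊤ : ℕ∞) f)
    (hg : ContDiff ℝ (⊤ : ℕ∞) g) : mderiv α (f + g) = mderiv α f + mderiv α g := by
  refine (mderiv_rel (R := fun a b c => ContDiff ℝ (⊤ : ℕ∞) b ∧ ContDiff ℝ (⊤ : ℕ∞) c ∧ a = b + c)
    ?_ α ⟨hf, hg, rfl⟩).2.2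
  rintro j a b c ⟨hb, hc, rfl⟩
  exact ⟨contDiff_pderiv j hb, contDiff_pderiv j hc, pderiv_add j hb hc⟩

lemma mderiv_smul (α : Fin N → ℕ) (c : ℂ) {f : EuclideanSpace ℝ (Fin N) → ℂ}
    (hf : ContDiff ℝ (⊤ : ℕ∞) f) : mderiv α (c • f) = c • mderiv α f := by
  refine (mderiv_rel (R := fun a b _ => ContDiff ℝ (⊤ : ℕ∞) b ∧ a = c • b)
    ?_ α (h := f) ⟨hf, rfl⟩).2
  rintro j a b _ ⟨hb, rfl⟩
  exact ⟨contDiff_pderiv j hb, pderiv_smul j c hb⟩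

lemma integrable_char_mul {f : EuclideanSpace ℝ (Fin N) → ℂ} (hf : MeasureTheory.Integrable f)
    (ξ : EuclideanSpace ℝ (Fin N)) :
    MeasureTheory.Integrable
      (fun x => Complex.exp (-(Complex.I * (inner ℝ x ξ : ℝ))) * f x) := by
  refine hf.bdd_mul (c := 1) (Continuous.aestronglyMeasurable (by fun_prop))
    (Filter.Eventually.of_forall fun x => le_of_eq ?_)
  rw [Complex.norm_exp]
  simp

lemma fourierT_add {f g : EuclideanSpace ℝ (Fin N) → ℂ} (hf : MeasureTheory.Integrable f)
    (hg : MeasureTheory.Integrable g) : fourierT (f + g) = fourierT f + fourierT g := by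
  funext ξ
  simp only [fourierT, Pi.add_apply, mul_add]
  exact MeasureTheory.integral_add (integrable_char_mul hf ξ) (integrable_char_mul hg ξ)

lemma fourierT_smul (c : ℂ) (f : EuclideanSpace ℝ (Fin N) → ℂ) :
    fourierT (c • f) = c • fourierT f := by
  funext ξ
  simp only [fourierT, Pi.smul_apply, smul_eq_mul]
  rw [← MeasureTheory.integral_const_mul]
  congr 1
  funext x
  ring

lemma WeightedSmooth.add {Ω : EuclideanSpace ℝ (Fin N) → ℝ} {f g : EuclideanSpace ℝ (Fin N) → ℂ}
    (hf : WeightedSmooth Ω f) (hg : WeightedSmooth Ω g) : WeightedSmooth Ω (f + g) := by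
  refine ⟨hf.1.add hg.1, fun l hl α => ?_⟩
  obtain ⟨A, hA⟩ := hf.2 l hl α
  obtain ⟨B, hB⟩ := hg.2 l hl α
  refine ⟨A + B, fun x => ?_⟩
  rw [mderiv_add α hf.1 hg.1]
  calc Real.exp (l * Ω x) * ‖mderiv α f x + mderiv α g x‖
      ≤ Real.exp (l * Ω x) * (‖mderiv α f x‖ + ‖mderiv α g x‖) := by
        gcongr; exact norm_add_le _ _
    _ ≤ A + B := by rw [mul_add]; exact add_le_add (hA x) (hB x)

lemma WeightedSmooth.smul {Ω : EuclideanSpace ℝ (Fin N) → ℝ} (c : ℂ)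
    {f : EuclideanSpace ℝ (Fin N) → ℂ}
    (hf : WeightedSmooth Ω f) : WeightedSmooth Ω (c • f) := by
  refine ⟨contDiff_const.smul hf.1, fun l hl α => ?_⟩
  obtain ⟨A, hA⟩ := hf.2 l hl α
  refine ⟨‖c‖ * A, fun x => ?_⟩
  rw [mderiv_smul α c hf.1, Pi.smul_apply, norm_smul, mul_left_comm]
  exact mul_le_mul_of_nonneg_left (hA x) (norm_nonneg c)

lemma WeightedSmooth.zero (Ω : EuclideanSpace ℝ (Fin N) → ℝ) :
    WeightedSmooth Ω (0 : EuclideanSpace ℝ (Fin N) → ℂ) := by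
  refine ⟨contDiff_const, fun l _ α => ⟨0, fun x => ?_⟩⟩
  have h := mderiv_smul α (0 : ℂ) (f := (0 : EuclideanSpace ℝ (Fin N) → ℂ)) contDiff_const
  simp only [zero_smul] at h
  simp [h]

/-! ### The space `S_Ω^Σ(ℝ^N)`, with `Ω = ⊕ ω_j` and `Σ = ⊕ σ_j` -/

/-- The functions `f ∈ L¹(ℝ^N)` such that `f` and `f̂` are smooth and, for all `l > 0` and all
multi-indices `α`, `‖exp(lΩ) D^α f‖_∞ < ∞` and `‖exp(lΣ) D^α f̂‖_∞ < ∞`. -/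
def spaceSubmodule (ω σ : Fin N → WeightFunction) :
    Submodule ℂ (EuclideanSpace ℝ (Fin N) → ℂ) where
  carrier := {f | MeasureTheory.Integrable f ∧ WeightedSmooth (directSum ω) f ∧
    WeightedSmooth (directSum σ) (fourierT f)}
  add_mem' := by
    rintro f g ⟨hf, hf1, hf2⟩ ⟨hg, hg1, hg2⟩
    exact ⟨hf.add hg, hf1.add hg1, by rw [fourierT_add hf hg]; exact hf2.add hg2⟩
  zero_mem' := by
    refine ⟨MeasureTheory.integrable_zero _ _ _, WeightedSmooth.zero _, ?_⟩
    have h := fourierT_smul (0 : ℂ) (0 : EuclideanSpace ℝ (Fin N) → ℂ)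
    simp only [zero_smul] at h
    rw [h]
    exact WeightedSmooth.zero _
  smul_mem' := by
    rintro c f ⟨hf, hf1, hf2⟩
    exact ⟨hf.smul c, hf1.smul c, by rw [fourierT_smul]; exact hf2.smul c⟩

/-- The space `S_Ω^Σ(ℝ^N)` as a type of its own, so that it carries its Fréchet topology and not
the topology of pointwise convergence. -/
def Space (ω σ : Fin N → WeightFunction) : Type := spaceSubmodule ω σ

instance (ω σ : Fin N → WeightFunction) : AddCommGroup (Space ω σ) :=
  inferInstanceAs (AddCommGroup (spaceSubmodule ω σ))

instance (ω σ : Fin N → WeightFunction) : Module ℂ (Space ω σ) :=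
  inferInstanceAs (Module ℂ (spaceSubmodule ω σ))

instance (ω σ : Fin N → WeightFunction) :
    CoeFun (Space ω σ) (fun _ => EuclideanSpace ℝ (Fin N) → ℂ) := ⟨fun f => f.1⟩

lemma bddAbove_of_weightedSmooth {Ω : EuclideanSpace ℝ (Fin N) → ℝ}
    {f : EuclideanSpace ℝ (Fin N) → ℂ}
    (hf : WeightedSmooth Ω f) (n : ℕ) (α : Fin N → ℕ) :
    BddAbove (Set.range fun x => Real.exp (((n : ℝ) + 1) * Ω x) * ‖mderiv α f x‖) := by
  obtain ⟨C, hC⟩ := hf.2 ((n : ℝ) + 1) (by positivity) α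
  exact ⟨C, by rintro _ ⟨x, rfl⟩; exact hC x⟩

/-- `‖exp((n+1)Ω) D^α f‖_∞`. -/
def weightedSup (Ω : EuclideanSpace ℝ (Fin N) → ℝ) (n : ℕ) (α : Fin N → ℕ)
    (f : EuclideanSpace ℝ (Fin N) → ℂ) : ℝ :=
  ⨆ x, Real.exp (((n : ℝ) + 1) * Ω x) * ‖mderiv α f x‖

lemma weightedSup_add {Ω : EuclideanSpace ℝ (Fin N) → ℝ} (n : ℕ) (α : Fin N → ℕ)
    {f g : EuclideanSpace ℝ (Fin N) → ℂ} (hf : WeightedSmooth Ω f) (hg : WeightedSmooth Ω g) :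
    weightedSup Ω n α (f + g) ≤ weightedSup Ω n α f + weightedSup Ω n α g := by
  refine ciSup_le fun x => ?_
  rw [mderiv_add α hf.1 hg.1]
  calc Real.exp (((n : ℝ) + 1) * Ω x) * ‖mderiv α f x + mderiv α g x‖
      ≤ Real.exp (((n : ℝ) + 1) * Ω x) * (‖mderiv α f x‖ + ‖mderiv α g x‖) := by
        gcongr; exact norm_add_le _ _
    _ ≤ _ := by
        rw [mul_add]
        exact add_le_add (le_ciSup (bddAbove_of_weightedSmooth hf n α) x)
          (le_ciSup (bddAbove_of_weightedSmooth hg n α) x)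

lemma weightedSup_smul {Ω : EuclideanSpace ℝ (Fin N) → ℝ} (n : ℕ) (α : Fin N → ℕ) (c : ℂ)
    {f : EuclideanSpace ℝ (Fin N) → ℂ} (hf : WeightedSmooth Ω f) :
    weightedSup Ω n α (c • f) = ‖c‖ * weightedSup Ω n α f := by
  rw [weightedSup, mderiv_smul α c hf.1, weightedSup, Real.mul_iSup_of_nonneg (norm_nonneg c)]
  congr 1
  funext x
  rw [Pi.smul_apply, norm_smul, mul_left_comm]

/-- The seminorm `f ↦ ‖exp((n+1)Ω) D^α f‖_∞`. -/
def seminormLeft (ω σ : Fin N → WeightFunction) (n : ℕ) (α : Fin N → ℕ) :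
    Seminorm ℂ (Space ω σ) :=
  Seminorm.of (fun f => weightedSup (directSum ω) n α f.1)
    (fun f g => weightedSup_add n α f.2.2.1 g.2.2.1)
    (fun c f => weightedSup_smul n α c f.2.2.1)

/-- The seminorm `f ↦ ‖exp((n+1)Σ) D^α f̂‖_∞`. -/
def seminormRight (ω σ : Fin N → WeightFunction) (n : ℕ) (α : Fin N → ℕ) :
    Seminorm ℂ (Space ω σ) :=
  Seminorm.of (fun f => weightedSup (directSum σ) n α (fourierT f.1))
    (fun f g => by
      have h := fourierT_add f.2.1 g.2.1
      change weightedSup (directSum σ) n α (fourierT (f.1 + g.1)) ≤ _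
      rw [h]
      exact weightedSup_add n α f.2.2.2 g.2.2.2)
    (fun c f => by
      change weightedSup (directSum σ) n α (fourierT (c • f.1)) = _
      rw [fourierT_smul]
      exact weightedSup_smul n α c f.2.2.2)

/-- The countable family of seminorms defining the topology of `S_Ω^Σ(ℝ^N)`. -/
def seminorms (ω σ : Fin N → WeightFunction) :
    SeminormFamily ℂ (Space ω σ) ((ℕ × (Fin N → ℕ)) ⊕ (ℕ × (Fin N → ℕ))) :=
  Sum.elim (fun p => seminormLeft ω σ p.1 p.2) (fun p => seminormRight ω σ p.1 p.2)

instance (ω σ : Fin N → WeightFunction) : TopologicalSpace (Space ω σ) :=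
  (seminorms ω σ).moduleFilterBasis.topology

lemma withSeminorms (ω σ : Fin N → WeightFunction) : WithSeminorms (seminorms ω σ) := ⟨rfl⟩

/-- The ultradistributions: continuous linear functionals on `S_Ω^Σ(ℝ^N)`. -/
abbrev Ultradistribution (ω σ : Fin N → WeightFunction) : Type := Space ω σ →L[ℂ] ℂ

/-- An ultradistribution belongs to `S_Ω^Σ(ℝ^N)` if it is `φ ↦ ∫ h(t) φ(t) dt` for some
`h ∈ S_Ω^Σ(ℝ^N)`. -/
def Ultradistribution.BelongsToSpace {ω σ : Fin N → WeightFunction}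
    (f : Ultradistribution ω σ) : Prop :=
  ∃ h : Space ω σ, ∀ φ : Space ω σ, f φ = ∫ t, h t * φ t

/-! ### Time-frequency shifts preserve the space -/

lemma WeightFunction.add_le (w : WeightFunction) : ∃ K : ℝ, 1 ≤ K ∧ ∀ x y : ℝ,
    w.toFun |x + y| ≤ K * (1 + w.toFun |x| + w.toFun |y|) := by
  obtain ⟨K, hK, h⟩ := w.doubling
  refine ⟨K, hK, fun x y => ?_⟩
  have hx := w.nonneg _ (abs_nonneg x)
  have hy := w.nonneg _ (abs_nonneg y)
  have hm : ∀ u v : ℝ, |v| ≤ |u| → w.toFun |u + v| ≤ K * (1 + w.toFun |u|) := fun u v huv =>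
    (w.monotoneOn (Set.mem_Ici.2 (abs_nonneg _)) (by simp) (by linarith [abs_add_le u v])).trans
      (h |u| (abs_nonneg u))
  rcases le_total |y| |x| with hxy | hxy
  · exact (hm x y hxy).trans (mul_le_mul_of_nonneg_left (by linarith) (by linarith))
  · rw [add_comm x y]
    exact (hm y x hxy).trans (mul_le_mul_of_nonneg_left (by linarith) (by linarith))

lemma directSum_nonneg (ω : Fin N → WeightFunction) (x : EuclideanSpace ℝ (Fin N)) :
    0 ≤ directSum ω x :=
  Finset.sum_nonneg fun j _ => (ω j).nonneg _ (abs_nonneg _)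

lemma directSum_neg (ω : Fin N → WeightFunction) (x : EuclideanSpace ℝ (Fin N)) :
    directSum ω (-x) = directSum ω x := by
  simp [directSum]

lemma directSum_add_le (ω : Fin N → WeightFunction) : ∃ K : ℝ, 0 < K ∧
    ∀ x y, directSum ω (x + y) ≤ K * (1 + directSum ω x + directSum ω y) := by
  choose K hK h using fun j => (ω j).add_le
  have hS : 0 ≤ ∑ j, K j := Finset.sum_nonneg fun j _ => zero_le_one.trans (hK j)
  refine ⟨1 + (N + 1) * ∑ j, K j, by positivity, fun x y => ?_⟩
  have hx := directSum_nonneg ω x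
  have hy := directSum_nonneg ω y
  have key : ∀ j ∈ Finset.univ, (ω j).toFun |(x + y) j| ≤
      (∑ i, K i) * (1 + directSum ω x + directSum ω y) := by
    intro j _
    have h1 : (ω j).toFun |x j| ≤ directSum ω x :=
      Finset.single_le_sum (f := fun j => (ω j).toFun |x j|)
        (fun i _ => (ω i).nonneg _ (abs_nonneg _)) (Finset.mem_univ j)
    have h2 : (ω j).toFun |y j| ≤ directSum ω y :=
      Finset.single_le_sum (f := fun j => (ω j).toFun |y j|)
        (fun i _ => (ω i).nonneg _ (abs_nonneg _)) (Finset.mem_univ j)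
    have h3 : K j ≤ ∑ i, K i :=
      Finset.single_le_sum (fun i _ => zero_le_one.trans (hK i)) (Finset.mem_univ j)
    have h4 := (ω j).nonneg _ (abs_nonneg (x j))
    have h5 := (ω j).nonneg _ (abs_nonneg (y j))
    calc (ω j).toFun |(x + y) j| ≤ K j * (1 + (ω j).toFun |x j| + (ω j).toFun |y j|) :=
          h j (x j) (y j)
      _ ≤ _ := by gcongr
  have := Finset.sum_le_sum key
  rw [Finset.sum_const, Finset.card_univ, Fintype.card_fin, nsmul_eq_mul] at this
  refine this.trans ?_
  nlinarith [mul_nonneg hS (show 0 ≤ 1 + directSum ω x + directSum ω y by positivity)]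

lemma pderiv_comm (i j : Fin N) {f : EuclideanSpace ℝ (Fin N) → ℂ} (hf : ContDiff ℝ (⊤ : ℕ∞) f) :
    pderiv i (pderiv j f) = pderiv j (pderiv i f) := by
  have h1 : ContDiff ℝ (⊤ : ℕ∞) (fderiv ℝ f) := hf.fderiv_right (by simp)
  have h2 : ∀ x, DifferentiableAt ℝ (fderiv ℝ f) x := h1.differentiable (by simp)
  have hsymm : ∀ x, IsSymmSndFDerivAt ℝ f x := fun x =>
    (hf.contDiffAt).isSymmSndFDerivAt (by
      rw [minSmoothness_of_isRCLikeNormedField]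
      exact WithTop.coe_le_coe.2 (le_top : (2 : ℕ∞) ≤ ⊤))
  have key : ∀ (k l : Fin N) (x : EuclideanSpace ℝ (Fin N)), pderiv k (pderiv l f) x =
      -Complex.I * (-Complex.I * fderiv ℝ (fderiv ℝ f) x (EuclideanSpace.single k 1)
        (EuclideanSpace.single l 1)) := by
    intro k l x
    have hd : DifferentiableAt ℝ (fun y => fderiv ℝ f y (EuclideanSpace.single l 1)) x :=
      (h2 x).clm_apply (differentiableAt_const _)
    have h3 : fderiv ℝ (pderiv l f) x = _ := fderiv_const_mul hd (-Complex.I)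
    rw [pderiv, h3, fderiv_clm_apply (h2 x) (differentiableAt_const _)]
    simp
  funext x
  rw [key, key, (hsymm x).eq]

lemma mderiv_pderiv (α : Fin N → ℕ) (i : Fin N) {f : EuclideanSpace ℝ (Fin N) → ℂ}
    (hf : ContDiff ℝ (⊤ : ℕ∞) f) : mderiv α (pderiv i f) = mderiv (α + Pi.single i 1) f := by
  have it : ∀ (j : Fin N) (n : ℕ) (h : EuclideanSpace ℝ (Fin N) → ℂ), ContDiff ℝ (⊤ : ℕ∞) h →
      ContDiff ℝ (⊤ : ℕ∞) ((pderiv j)^[n] h) ∧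
        (pderiv j)^[n] (pderiv i h) = pderiv i ((pderiv j)^[n] h) := by
    intro j n
    induction n with
    | zero => intro h hh; exact ⟨hh, rfl⟩
    | succ n ih =>
      intro h hh
      rw [Function.iterate_succ_apply, Function.iterate_succ_apply, pderiv_comm j i hh]
      exact ih _ (contDiff_pderiv j hh)
  have fo : ∀ l : List (Fin N), ContDiff ℝ (⊤ : ℕ∞) (l.foldr (fun j h => (pderiv j)^[α j] h) f) ∧
      l.foldr (fun j h => (pderiv j)^[α j] h) (pderiv i f) =
        pderiv i (l.foldr (fun j h => (pderiv j)^[α j] h) f) := by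
    intro l
    induction l with
    | nil => exact ⟨hf, rfl⟩
    | cons j t ih =>
      refine ⟨(it j _ _ ih.1).1, ?_⟩
      rw [List.foldr_cons, ih.2, (it j _ _ ih.1).2, List.foldr_cons]
  have no : ∀ l : List (Fin N), i ∉ l → l.foldr (fun j h => (pderiv j)^[α j] h) f =
      l.foldr (fun j h => (pderiv j)^[(α + Pi.single i 1 : Fin N → ℕ) j] h) f := by
    intro l
    induction l with
    | nil => intro _; rfl
    | cons j t ih =>
      intro hi
      rw [List.mem_cons, not_or] at hi
      rw [List.foldr_cons, List.foldr_cons, ih hi.2]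
      simp [Pi.single_eq_of_ne (Ne.symm hi.1)]
  have main : ∀ l : List (Fin N), l.Nodup → i ∈ l →
      l.foldr (fun j h => (pderiv j)^[α j] h) (pderiv i f) =
      l.foldr (fun j h => (pderiv j)^[(α + Pi.single i 1 : Fin N → ℕ) j] h) f := by
    intro l
    induction l with
    | nil => intro _ h; simp at h
    | cons j t ih =>
      intro hn hi
      rw [List.nodup_cons] at hn
      rw [List.foldr_cons, List.foldr_cons]
      by_cases hij : j = i
      · subst hij
        rw [(fo t).2, no t hn.1, Pi.add_apply, Pi.single_eq_same, Function.iterate_succ_apply]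
      · have hit : i ∈ t := by
          rcases List.mem_cons.1 hi with h | h
          · exact absurd h.symm hij
          · exact h
        rw [ih hn.2 hit]
        simp [Pi.single_eq_of_ne hij]
  exact main _ (List.nodup_finRange N) (List.mem_finRange i)

lemma WeightedSmooth.pderiv {Ω : EuclideanSpace ℝ (Fin N) → ℝ}
    {f : EuclideanSpace ℝ (Fin N) → ℂ} (hf : WeightedSmooth Ω f) (j : Fin N) :
    WeightedSmooth Ω (pderiv j f) :=
  ⟨contDiff_pderiv j hf.1, fun l hl α => by
    rw [mderiv_pderiv α j hf.1]; exact hf.2 l hl _⟩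

lemma mderiv_zero (f : EuclideanSpace ℝ (Fin N) → ℂ) : mderiv 0 f = f := by
  have : ∀ l : List (Fin N),
      l.foldr (fun j h => (Beurling.pderiv j)^[(0 : Fin N → ℕ) j] h) f = f := by
    intro l
    induction l with
    | nil => rfl
    | cons j t ih => rw [List.foldr_cons, ih]; rfl
  exact this _

/-- A set of smooth functions, stable under all `D_j`, whose elements decay faster than every
`exp(-lΩ)`, consists of elements of `WeightedSmooth Ω`. -/
lemma weightedSmooth_of_stable {Ω : EuclideanSpace ℝ (Fin N) → ℝ}
    {T : Set (EuclideanSpace ℝ (Fin N) → ℂ)} (h1 : ∀ f ∈ T, ContDiff ℝ (⊤ : ℕ∞) f)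
    (h2 : ∀ f ∈ T, ∀ l : ℝ, 0 < l → ∃ C : ℝ, ∀ x, Real.exp (l * Ω x) * ‖f x‖ ≤ C)
    (h3 : ∀ j, ∀ f ∈ T, Beurling.pderiv j f ∈ T) {f : EuclideanSpace ℝ (Fin N) → ℂ}
    (hf : f ∈ T) : WeightedSmooth Ω f :=
  ⟨h1 f hf, fun l hl α => h2 _ (mderiv_mem h3 α hf) l hl⟩

lemma WeightedSmooth.bound {Ω : EuclideanSpace ℝ (Fin N) → ℝ}
    {f : EuclideanSpace ℝ (Fin N) → ℂ} (hf : WeightedSmooth Ω f) (l : ℝ) (hl : 0 < l) :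
    ∃ C : ℝ, ∀ x, Real.exp (l * Ω x) * ‖f x‖ ≤ C := by
  simpa only [mderiv_zero] using hf.2 l hl 0

lemma WeightedSmooth.translate {ω : Fin N → WeightFunction} {f : EuclideanSpace ℝ (Fin N) → ℂ}
    (hf : WeightedSmooth (directSum ω) f) (x : EuclideanSpace ℝ (Fin N)) :
    WeightedSmooth (directSum ω) (fun t => f (t - x)) := by
  refine weightedSmooth_of_stable
    (T := {k | ∃ h, WeightedSmooth (directSum ω) h ∧ k = fun t => h (t - x)}) ?_ ?_ ?_ ⟨f, hf, rfl⟩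
  · rintro _ ⟨h, hh, rfl⟩
    exact hh.1.comp (contDiff_id.sub contDiff_const)
  · rintro _ ⟨h, hh, rfl⟩ l hl
    obtain ⟨K, hK, hadd⟩ := directSum_add_le ω
    obtain ⟨C, hC⟩ := hh.bound (l * K) (by positivity)
    refine ⟨Real.exp (l * K * (1 + directSum ω x)) * C, fun t => ?_⟩
    have h1 := hadd (t - x) x
    rw [sub_add_cancel] at h1
    have h2 : l * directSum ω t ≤ l * K * (1 + directSum ω x) + l * K * directSum ω (t - x) := by
      nlinarith
    calc Real.exp (l * directSum ω t) * ‖h (t - x)‖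
        ≤ Real.exp (l * K * (1 + directSum ω x) + l * K * directSum ω (t - x)) * ‖h (t - x)‖ := by
          gcongr
      _ = Real.exp (l * K * (1 + directSum ω x)) *
            (Real.exp (l * K * directSum ω (t - x)) * ‖h (t - x)‖) := by
          rw [Real.exp_add, mul_assoc]
      _ ≤ _ := by gcongr; exact hC _
  · rintro j _ ⟨h, hh, rfl⟩
    refine ⟨_, hh.pderiv j, ?_⟩
    funext t
    simp only [Beurling.pderiv, fderiv_comp_sub]

lemma WeightedSmooth.conj {Ω : EuclideanSpace ℝ (Fin N) → ℝ} {f : EuclideanSpace ℝ (Fin N) → ℂ}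
    (hf : WeightedSmooth Ω f) : WeightedSmooth Ω (fun t => (starRingEnd ℂ) (f t)) := by
  refine weightedSmooth_of_stable
    (T := {k | ∃ h, WeightedSmooth Ω h ∧ k = fun t => (starRingEnd ℂ) (h t)}) ?_ ?_ ?_ ⟨f, hf, rfl⟩
  · rintro _ ⟨h, hh, rfl⟩
    exact Complex.conjCLE.contDiff.comp hh.1
  · rintro _ ⟨h, hh, rfl⟩ l hl
    simpa using hh.bound l hl
  · rintro j _ ⟨h, hh, rfl⟩
    refine ⟨_, (hh.pderiv j).smul (-1), ?_⟩
    funext t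
    have hd := (hh.1.differentiable (by simp)) t
    have h1 : fderiv ℝ (fun t => (starRingEnd ℂ) (h t)) t =
        (Complex.conjCLE : ℂ →L[ℝ] ℂ).comp (fderiv ℝ h t) :=
      ((Complex.conjCLE : ℂ →L[ℝ] ℂ).hasFDerivAt.comp t hd.hasFDerivAt).fderiv
    simp [Beurling.pderiv, h1]

lemma WeightedSmooth.reflect {ω : Fin N → WeightFunction} {f : EuclideanSpace ℝ (Fin N) → ℂ}
    (hf : WeightedSmooth (directSum ω) f) : WeightedSmooth (directSum ω) (fun t => f (-t)) := by
  refine weightedSmooth_of_stable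
    (T := {k | ∃ h, WeightedSmooth (directSum ω) h ∧ k = fun t => h (-t)}) ?_ ?_ ?_ ⟨f, hf, rfl⟩
  · rintro _ ⟨h, hh, rfl⟩
    exact hh.1.comp contDiff_neg
  · rintro _ ⟨h, hh, rfl⟩ l hl
    obtain ⟨C, hC⟩ := hh.bound l hl
    exact ⟨C, fun t => by simpa only [directSum_neg] using hC (-t)⟩
  · rintro j _ ⟨h, hh, rfl⟩
    refine ⟨_, (hh.pderiv j).smul (-1), ?_⟩
    funext t
    have hd := (hh.1.differentiable (by simp)) (-t)
    have h1 : fderiv ℝ (fun t => h (-t)) t =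
        (fderiv ℝ h (-t)).comp (-ContinuousLinearMap.id ℝ (EuclideanSpace ℝ (Fin N))) :=
      (hd.hasFDerivAt.comp t (hasFDerivAt_id t).neg).fderiv
    simp [Beurling.pderiv, h1]

lemma WeightedSmooth.modulate {Ω : EuclideanSpace ℝ (Fin N) → ℝ}
    {f : EuclideanSpace ℝ (Fin N) → ℂ} (hf : WeightedSmooth Ω f) (ξ : EuclideanSpace ℝ (Fin N)) :
    WeightedSmooth Ω (fun t => Complex.exp (-(Complex.I * (inner ℝ t ξ : ℝ))) * f t) := by
  have hphase : ∀ t, HasFDerivAt (fun t : EuclideanSpace ℝ (Fin N) =>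
      Complex.exp (-(Complex.I * (inner ℝ t ξ : ℝ))))
      (Complex.exp (-(Complex.I * (inner ℝ t ξ : ℝ))) •
        (-(Complex.I • (Complex.ofRealCLM.comp (innerSL ℝ ξ))))) t := by
    intro t
    have h0 : HasFDerivAt (fun t : EuclideanSpace ℝ (Fin N) => ((inner ℝ t ξ : ℝ) : ℂ))
        (Complex.ofRealCLM.comp (innerSL ℝ ξ)) t := by
      have := (Complex.ofRealCLM.comp (innerSL ℝ ξ)).hasFDerivAt (x := t)
      refine this.congr_of_eventuallyEq (Filter.Eventually.of_forall fun s => ?_)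
      simp [real_inner_comm]
    exact ((h0.const_mul Complex.I).neg).cexp
  have hcd : ContDiff ℝ (⊤ : ℕ∞) (fun t : EuclideanSpace ℝ (Fin N) =>
      Complex.exp (-(Complex.I * (inner ℝ t ξ : ℝ)))) :=
    ((contDiff_const.mul
      (Complex.ofRealCLM.contDiff.comp (contDiff_id.inner ℝ contDiff_const))).neg).cexp
  refine weightedSmooth_of_stable
    (T := {k | ∃ h, WeightedSmooth Ω h ∧
      k = fun t => Complex.exp (-(Complex.I * (inner ℝ t ξ : ℝ))) * h t}) ?_ ?_ ?_ ⟨f, hf, rfl⟩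
  · rintro _ ⟨h, hh, rfl⟩
    exact hcd.mul hh.1
  · rintro _ ⟨h, hh, rfl⟩ l hl
    obtain ⟨C, hC⟩ := hh.bound l hl
    refine ⟨C, fun t => ?_⟩
    have : ‖Complex.exp (-(Complex.I * (inner ℝ t ξ : ℝ)))‖ = 1 := by
      rw [Complex.norm_exp]; simp
    rw [norm_mul, this, one_mul]
    exact hC t
  · rintro j _ ⟨h, hh, rfl⟩
    refine ⟨_, (hh.pderiv j).add (hh.smul (-(ξ j : ℂ))), ?_⟩
    funext t
    have hd := (hh.1.differentiable (by simp)) t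
    have h1 := ((hphase t).mul hd.hasFDerivAt).fderiv
    have hin : inner ℝ ξ (EuclideanSpace.single j (1 : ℝ)) = ξ j := by
      simp [EuclideanSpace.inner_single_right]
    rw [Beurling.pderiv, show fderiv ℝ (fun t => Complex.exp (-(Complex.I * (inner ℝ t ξ : ℝ))) * h t) t = _ from h1]
    simp only [add_apply, smul_apply,
      neg_apply, ContinuousLinearMap.comp_apply, innerSL_apply_apply, hin,
      Complex.ofRealCLM_apply, smul_eq_mul, Pi.add_apply, Pi.smul_apply, Beurling.pderiv]
    linear_combination (Complex.exp (-(Complex.I * (inner ℝ t ξ : ℝ))) * h t * (ξ j : ℂ)) *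
      Complex.I_mul_I

lemma fourierT_translate (f : EuclideanSpace ℝ (Fin N) → ℂ) (x : EuclideanSpace ℝ (Fin N)) :
    fourierT (fun t => f (t - x)) =
      fun η => Complex.exp (-(Complex.I * (inner ℝ η x : ℝ))) * fourierT f η := by
  funext η
  simp only [fourierT]
  rw [← MeasureTheory.integral_const_mul, ← MeasureTheory.integral_add_right_eq_self _ x]
  congr 1
  funext t
  rw [add_sub_cancel_right, ← mul_assoc, ← Complex.exp_add, inner_add_left,
    real_inner_comm x η]
  congr 2
  push_cast
  ring

lemma fourierT_modulate (f : EuclideanSpace ℝ (Fin N) → ℂ) (ξ : EuclideanSpace ℝ (Fin N)) :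
    fourierT (fun t => Complex.exp (-(Complex.I * (inner ℝ t ξ : ℝ))) * f t) =
      fun η => fourierT f (η - -ξ) := by
  funext η
  simp only [fourierT]
  congr 1
  funext t
  rw [← mul_assoc, ← Complex.exp_add, sub_neg_eq_add, inner_add_right]
  congr 2
  push_cast
  ring

lemma fourierT_conj (f : EuclideanSpace ℝ (Fin N) → ℂ) :
    fourierT (fun t => (starRingEnd ℂ) (f t)) =
      fun η => (starRingEnd ℂ) (fourierT f (-η)) := by
  funext η
  simp only [fourierT]
  rw [← integral_conj]
  congr 1
  funext t
  rw [map_mul, ← Complex.exp_conj]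
  congr 2
  simp

/-- `t ↦ exp(-i t·ξ) conj(g(t - x))`, as an element of `S_Ω^Σ(ℝ^N)` for `g ∈ S_Ω^Σ(ℝ^N)`. -/
def conjShift {ω σ : Fin N → WeightFunction} (g : Space ω σ) (x ξ : EuclideanSpace ℝ (Fin N)) :
    Space ω σ :=
  ⟨fun t => Complex.exp (-(Complex.I * (inner ℝ t ξ : ℝ))) * (starRingEnd ℂ) (g (t - x)), by
    obtain ⟨g, hg, hg1, hg2⟩ := g
    refine ⟨?_, (hg1.translate x).conj.modulate ξ, ?_⟩
    · have h := Complex.conjCLE.toContinuousLinearMap.integrable_comp (hg.comp_sub_right x)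
      exact integrable_char_mul h ξ
    · change WeightedSmooth (directSum σ) (fourierT (fun t =>
        Complex.exp (-(Complex.I * (inner ℝ t ξ : ℝ))) *
          (fun s => (starRingEnd ℂ) ((fun r => g (r - x)) s)) t))
      rw [fourierT_modulate, fourierT_conj, fourierT_translate]
      exact ((hg2.modulate x).reflect.conj).translate (-ξ)⟩

/-- The short-time Fourier transform `V_g f(x, ξ) = ⟨f, exp(-i t·ξ) conj(g(t - x))⟩` of an
ultradistribution `f`; it is `∫ exp(-i t·ξ) f(t) conj(g(t - x)) dt` if `f` is a function. -/
def stft {ω σ : Fin N → WeightFunction} (g : Space ω σ) (f : Ultradistribution ω σ)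
    (x ξ : EuclideanSpace ℝ (Fin N)) : ℂ :=
  f (conjShift g x ξ)

end Beurling

end

/-! ### Growth of the weights and rapid decay. -/

namespace Beurling

open MeasureTheory

variable {N : ℕ}

/-! Write `conjShift g x ξ` for the test function in the definition of `V_g f`.

If `f` is a function `h` of the space, `|V_g h(x, ξ)|` has two bounds. Taking absolute values gives
the integral of `|h(t)| |g(t - x)|`, which decays in `Ω(x)`; Parseval's formula gives the same
expression for `ĥ` and `ĝ`, which decays in `Σ(ξ)`. The geometric mean of the two bounds decays in
`Ω(x) + Σ(ξ)` (`rapidDecay_integral_mul_conjShift`).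

For the converse, Fourier inversion for fixed `x`, followed by integration in `x`, gives the
reproducing formula `k φ = ∫ A(x, -ξ) conjShift g x ξ` for every test function `φ`, with `A(x, ξ) =
∫ φ · conjShift ḡ x ξ` and `k = (2π)^N ‖g‖₂² ≠ 0` (`integral_stft_mul_conjShift`). Applying `f`
under the integral yields `k f(φ) = ∫ A(x, -ξ) V_g f(x, ξ)`. On the other hand `h = ∫ V_g f(x, -ξ)
conjShift ḡ x ξ` lies in the space because its coefficients decay rapidly, and pairing `h` with `φ`
under the integral gives the same value after `ξ ↦ -ξ`. Hence `f` is the function `h / k`.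

Both interchanges are instances of `exists_integral_conjShift`: a superposition of time-frequency
shifts with rapidly decreasing coefficients is an element of the space and commutes with every
continuous functional. The shifts and their Fourier transforms are families of smooth functions
whose weighted derivatives grow at most like a power of `exp (Ω(x) + Σ(ξ))` (`GoodFamily`), so
rapidly decreasing coefficients allow differentiation under the integral. A continuous functional is
dominated by finitely many seminorms, each of them the norm of an image in a Banach space of bounded
continuous functions; Hahn–Banach extends it to their product, where Bochner integrals are available
(`map_eq_integral_of_le_norm`). -/

lemma continuous_directSum (ω : Fin N → WeightFunction) : Continuous (directSum ω) := by
  unfold directSum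
  refine continuous_finsetSum Finset.univ fun j _ => ?_
  refine (ω j).continuousOn.comp_continuous (by fun_prop) fun x => ?_
  exact Set.mem_Ici.2 (abs_nonneg (x j))

lemma le_directSum (ω : Fin N → WeightFunction) (x : EuclideanSpace ℝ (Fin N)) (j : Fin N) :
    (ω j).toFun |x j| ≤ directSum ω x :=
  Finset.single_le_sum (f := fun j => (ω j).toFun |x j|)
    (fun i _ => (ω i).nonneg _ (abs_nonneg _)) (Finset.mem_univ j)

lemma norm_le_sum_abs (x : EuclideanSpace ℝ (Fin N)) : ‖x‖ ≤ ∑ j, |x j| := by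
  rw [EuclideanSpace.norm_eq]
  refine Real.sqrt_le_iff.2 ⟨Finset.sum_nonneg fun j _ => abs_nonneg _, ?_⟩
  simp only [Real.norm_eq_abs]
  exact Finset.sum_sq_le_sq_sum_of_nonneg fun j _ => abs_nonneg _

/-- Weights grow at least logarithmically. -/
lemma one_add_norm_le_exp (ω : Fin N → WeightFunction) : ∃ C k : ℝ, 0 < C ∧ 0 < k ∧
    ∀ x, 1 + ‖x‖ ≤ C * Real.exp (k * directSum ω x) := by
  choose a b hb h using fun j => (ω j).log_le
  have hbi : 0 ≤ ∑ j, (b j)⁻¹ := Finset.sum_nonneg fun j _ => (inv_pos.2 (hb j)).le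
  -- Condition (γ) bounds `|x j|` by the `j`-th exponential times `exp (Ω / b j)`. The first `1 +`
  -- pays for the `1` in `1 + ‖x‖`; the second keeps the exponent positive when `N = 0`.
  refine ⟨1 + ∑ j, Real.exp (|a j| * (b j)⁻¹), 1 + ∑ j, (b j)⁻¹, by positivity, by positivity,
    fun x => ?_⟩
  have hx := directSum_nonneg ω x
  have h1 : ∀ j, |x j| ≤ Real.exp (|a j| * (b j)⁻¹) *
      Real.exp ((1 + ∑ j, (b j)⁻¹) * directSum ω x) := by
    intro j
    have hpos : 0 < 1 + |x j| := by positivity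
    have h2 : Real.log (1 + |x j|) ≤ |a j| * (b j)⁻¹ + (b j)⁻¹ * directSum ω x := by
      have h3 := h j |x j| (abs_nonneg _)
      have h4 := le_directSum ω x j
      have h5 := neg_abs_le (a j)
      have h6 : b j * Real.log (1 + |x j|) ≤ |a j| + directSum ω x := by linarith
      calc Real.log (1 + |x j|) = (b j)⁻¹ * (b j * Real.log (1 + |x j|)) := by
            rw [inv_mul_cancel_left₀ (hb j).ne']
        _ ≤ (b j)⁻¹ * (|a j| + directSum ω x) :=
            mul_le_mul_of_nonneg_left h6 (inv_pos.2 (hb j)).le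
        _ = _ := by ring
    have h7 : (b j)⁻¹ ≤ 1 + ∑ j, (b j)⁻¹ := by
      have := Finset.single_le_sum (f := fun j => (b j)⁻¹)
        (fun i _ => (inv_pos.2 (hb i)).le) (Finset.mem_univ j)
      linarith
    rw [← Real.exp_add]
    calc |x j| ≤ 1 + |x j| := by linarith
      _ = Real.exp (Real.log (1 + |x j|)) := (Real.exp_log hpos).symm
      _ ≤ _ := Real.exp_le_exp.2 (h2.trans (by gcongr))
  have h8 : (1 : ℝ) ≤ Real.exp ((1 + ∑ j, (b j)⁻¹) * directSum ω x) :=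
    Real.one_le_exp (by positivity)
  rw [add_mul, one_mul, Finset.sum_mul]
  exact add_le_add h8 ((norm_le_sum_abs x).trans (Finset.sum_le_sum fun j _ => h1 j))

/-- A large multiple of the weight beats `(1 + ‖x‖)^(N + 1)`, and the exponent `N + 1` exceeds the
dimension. -/
lemma integrable_exp_neg_directSum (ω : Fin N → WeightFunction) : ∃ M : ℝ, 0 < M ∧
    Integrable (fun x => Real.exp (-M * directSum ω x)) := by
  obtain ⟨C, k, hC, hk, h⟩ := one_add_norm_le_exp ω
  refine ⟨k * (N + 1 : ℕ), by positivity, ?_⟩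
  have hi : Integrable (fun x : EuclideanSpace ℝ (Fin N) =>
      C ^ (N + 1) * (1 + ‖x‖) ^ (-((N + 1 : ℕ) : ℝ))) :=
    (integrable_one_add_norm (by simp)).const_mul _
  refine hi.mono' (by have := continuous_directSum ω; fun_prop) (Filter.Eventually.of_forall
    fun x => ?_)
  have hpos : 0 < 1 + ‖x‖ := by positivity
  rw [Real.norm_eq_abs, abs_of_pos (Real.exp_pos _), Real.rpow_neg hpos.le, Real.rpow_natCast,
    show -(k * ((N + 1 : ℕ) : ℝ)) * directSum ω x = -(((N + 1 : ℕ) : ℝ) * (k * directSum ω x)) by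
      ring, Real.exp_neg, Real.exp_nat_mul, ← div_eq_mul_inv, inv_eq_one_div,
    div_le_div_iff₀ (by positivity) (by positivity), one_mul, ← mul_pow]
  exact pow_le_pow_left₀ hpos.le (h x) _

lemma exp_mul_le_iff {a b C : ℝ} : Real.exp a * b ≤ C ↔ b ≤ C * Real.exp (-a) := by
  rw [Real.exp_neg, ← div_eq_mul_inv, le_div_iff₀ (Real.exp_pos _), mul_comm]

lemma nonneg_of_exp_mul_norm_le {X Y : Type*} [Inhabited X] [NormedAddCommGroup Y] {a : X → ℝ}
    {u : X → Y} {C : ℝ} (h : ∀ x, Real.exp (a x) * ‖u x‖ ≤ C) : 0 ≤ C :=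
  (by positivity : 0 ≤ Real.exp (a default) * ‖u default‖).trans (h default)

lemma integrable_of_decay {ω : Fin N → WeightFunction} {u : EuclideanSpace ℝ (Fin N) → ℂ}
    (hu : Continuous u)
    (h : ∀ l : ℝ, 0 < l → ∃ C : ℝ, ∀ x, Real.exp (l * directSum ω x) * ‖u x‖ ≤ C) :
    Integrable u := by
  obtain ⟨M, hM, hi⟩ := integrable_exp_neg_directSum ω
  obtain ⟨C, hC⟩ := h M hM
  refine (hi.const_mul C).mono' hu.aestronglyMeasurable (Filter.Eventually.of_forall fun x => ?_)
  have := exp_mul_le_iff.1 (hC x)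
  rwa [neg_mul]

lemma WeightedSmooth.integrable {ω : Fin N → WeightFunction} {u : EuclideanSpace ℝ (Fin N) → ℂ}
    (hu : WeightedSmooth (directSum ω) u) : Integrable u :=
  integrable_of_decay hu.1.continuous fun l hl => hu.bound l hl

/-- Convolutions of rapidly decreasing functions decrease rapidly. -/
lemma integral_norm_mul_norm_sub_le {ω : Fin N → WeightFunction}
    {u v : EuclideanSpace ℝ (Fin N) → ℂ}
    (hu : ∀ l : ℝ, 0 < l → ∃ C : ℝ, ∀ x, Real.exp (l * directSum ω x) * ‖u x‖ ≤ C)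
    (hv : ∀ l : ℝ, 0 < l → ∃ C : ℝ, ∀ x, Real.exp (l * directSum ω x) * ‖v x‖ ≤ C)
    (l : ℝ) (hl : 0 < l) : ∃ C : ℝ, 0 ≤ C ∧ ∀ x,
      ∫ t, ‖u t‖ * ‖v (t - x)‖ ≤ C * Real.exp (-l * directSum ω x) := by
  obtain ⟨M, hM, hi⟩ := integrable_exp_neg_directSum ω
  obtain ⟨K, hK, hadd⟩ := directSum_add_le ω
  -- Since `Ω(x) ≤ K (1 + Ω(t) + Ω(t - x))`, decay `l * K` in each factor pays for `exp (-l Ω(x))`;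
  -- the extra `M` makes the bound integrable in `t`.
  obtain ⟨A, hA⟩ := hu (M + l * K) (by positivity)
  obtain ⟨B, hB⟩ := hv (l * K) (by positivity)
  have hA0 := nonneg_of_exp_mul_norm_le hA
  have hB0 := nonneg_of_exp_mul_norm_le hB
  refine ⟨A * B * Real.exp (l * K) * ∫ t, Real.exp (-M * directSum ω t), by positivity,
    fun x => ?_⟩
  have key : ∀ t, ‖u t‖ * ‖v (t - x)‖ ≤
      A * B * Real.exp (l * K) * Real.exp (-l * directSum ω x) * Real.exp (-M * directSum ω t) := by
    intro t
    have h1 := exp_mul_le_iff.1 (hA t)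
    have h2 := exp_mul_le_iff.1 (hB (t - x))
    have h3 := hadd t (-(t - x))
    rw [directSum_neg, show t + -(t - x) = x by abel] at h3
    calc ‖u t‖ * ‖v (t - x)‖ ≤ (A * Real.exp (-((M + l * K) * directSum ω t))) *
          (B * Real.exp (-(l * K * directSum ω (t - x)))) := by gcongr
      _ = A * B * Real.exp (-((M + l * K) * directSum ω t) + -(l * K * directSum ω (t - x))) := by
          rw [Real.exp_add]; ring
      _ ≤ A * B * Real.exp (l * K + (-l * directSum ω x) + (-M * directSum ω t)) := by
          have h4 := mul_le_mul_of_nonneg_left h3 hl.le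
          refine mul_le_mul_of_nonneg_left (Real.exp_le_exp.2 ?_) (by positivity)
          linarith
      _ = _ := by rw [Real.exp_add, Real.exp_add]; ring
  calc ∫ t, ‖u t‖ * ‖v (t - x)‖ ≤ ∫ t, A * B * Real.exp (l * K) * Real.exp (-l * directSum ω x) *
        Real.exp (-M * directSum ω t) :=
        integral_mono_of_nonneg (Filter.Eventually.of_forall fun t => by positivity)
          (hi.const_mul _) (Filter.Eventually.of_forall key)
    _ = _ := by rw [integral_const_mul]; ring

end Beurling

namespace Beurling

open MeasureTheory

variable {N : ℕ} {P : Type*}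

/-! ### Families of functions depending on a parameter -/

/-- The relation ties a single function to a whole family, so that the induction over `D^α` can
carry a statement such as "this function is the integral of that family". -/
lemma mderiv_family_rel
    {R : (EuclideanSpace ℝ (Fin N) → ℂ) → (P → EuclideanSpace ℝ (Fin N) → ℂ) → Prop}
    (hR : ∀ j h ψ, R h ψ → R (pderiv j h) (fun p => pderiv j (ψ p))) (α : Fin N → ℕ)
    {h : EuclideanSpace ℝ (Fin N) → ℂ} {ψ : P → EuclideanSpace ℝ (Fin N) → ℂ} (H : R h ψ) :
    R (mderiv α h) (fun p => mderiv α (ψ p)) := by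
  have it : ∀ j (n : ℕ) h ψ, R h ψ → R ((pderiv j)^[n] h) (fun p => (pderiv j)^[n] (ψ p)) := by
    intro j n
    induction n with
    | zero => exact fun h ψ H => H
    | succ n ih => exact fun h ψ H => ih _ _ (hR j _ _ H)
  have key : ∀ l : List (Fin N), R (l.foldr (fun j h => (pderiv j)^[α j] h) h)
      (fun p => l.foldr (fun j h => (pderiv j)^[α j] h) (ψ p)) := by
    intro l
    induction l with
    | nil => exact H
    | cons j t ih => exact it _ _ _ _ ih
  exact key _

/-- The coordinate `x ↦ x_j` as a complex valued continuous linear map. -/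
noncomputable def coordCLM (j : Fin N) : EuclideanSpace ℝ (Fin N) →L[ℝ] ℂ :=
  Complex.ofRealCLM.comp (EuclideanSpace.proj j)

lemma fderiv_eq_sum_pderiv (f : EuclideanSpace ℝ (Fin N) → ℂ) (x : EuclideanSpace ℝ (Fin N)) :
    fderiv ℝ f x = ∑ j, (Complex.I * pderiv j f x) • coordCLM j := by
  refine ContinuousLinearMap.coe_injective
    ((EuclideanSpace.basisFun (Fin N) ℝ).toBasis.ext fun i => ?_)
  simp only [ContinuousLinearMap.coe_coe, OrthonormalBasis.coe_toBasis, EuclideanSpace.basisFun_apply,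
    FunLike.coe_sum, Finset.sum_apply]
  rw [Finset.sum_eq_single i]
  · simp [coordCLM, pderiv, ← mul_assoc]
  · intro j _ hj
    simp [coordCLM, hj]
  · simp

/-- The total derivative is a combination of the `D_j f`, which lie in `T` again, so
differentiability bootstraps by induction on the order. -/
lemma contDiff_of_stable {T : Set (EuclideanSpace ℝ (Fin N) → ℂ)}
    (h1 : ∀ f ∈ T, Differentiable ℝ f) (h2 : ∀ j, ∀ f ∈ T, pderiv j f ∈ T)
    {f : EuclideanSpace ℝ (Fin N) → ℂ} (hf : f ∈ T) : ContDiff ℝ (⊤ : ℕ∞) f := by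
  rw [contDiff_infty]
  intro n
  induction n generalizing f with
  | zero => exact contDiff_zero.2 (h1 f hf).continuous
  | succ n ih =>
    push_cast
    rw [contDiff_succ_iff_fderiv]
    refine ⟨h1 f hf, by simp, ?_⟩
    have : fderiv ℝ f = fun x => ∑ j, (Complex.I * pderiv j f x) • coordCLM j :=
      funext fun x => fderiv_eq_sum_pderiv f x
    rw [this]
    exact ContDiff.sum fun j _ => (contDiff_const.mul (ih (h2 j f hf))).smul contDiff_const

/-- `q` grows at most like a power of `exp W`. -/
def ModerateGrowth (W : P → ℝ) (q : P → ℂ) : Prop :=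
  ∃ C m : ℝ, 0 ≤ C ∧ ∀ p, ‖q p‖ ≤ C * Real.exp (m * W p)

/-- `b` decreases faster than every power of `exp (-W)`. -/
def RapidDecay (W : P → ℝ) (b : P → ℂ) : Prop :=
  ∀ l : ℝ, 0 < l → ∃ C : ℝ, 0 ≤ C ∧ ∀ p, ‖b p‖ ≤ C * Real.exp (-l * W p)

lemma ModerateGrowth.mul {W : P → ℝ} {q r : P → ℂ} (hq : ModerateGrowth W q)
    (hr : ModerateGrowth W r) : ModerateGrowth W (fun p => q p * r p) := by
  obtain ⟨C, m, hC, h⟩ := hq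
  obtain ⟨C', m', hC', h'⟩ := hr
  refine ⟨C * C', m + m', by positivity, fun p => ?_⟩
  rw [norm_mul]
  calc ‖q p‖ * ‖r p‖ ≤ (C * Real.exp (m * W p)) * (C' * Real.exp (m' * W p)) := by
        gcongr
        · exact h p
        · exact h' p
    _ = _ := by rw [add_mul, Real.exp_add]; ring

variable [TopologicalSpace P]

/-- A family of smooth functions, all of whose derivatives are jointly continuous and decrease
rapidly, with constants that grow at most like a power of `exp W`. -/
structure GoodFamily (Ω : EuclideanSpace ℝ (Fin N) → ℝ) (W : P → ℝ)
    (ψ : P → EuclideanSpace ℝ (Fin N) → ℂ) : Prop where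
  contDiff : ∀ p, ContDiff ℝ (⊤ : ℕ∞) (ψ p)
  continuous : ∀ α, Continuous fun r : P × EuclideanSpace ℝ (Fin N) => mderiv α (ψ r.1) r.2
  bound : ∀ α l, 0 < l → ∃ C m : ℝ, 0 ≤ C ∧
    ∀ p t, Real.exp (l * Ω t) * ‖mderiv α (ψ p) t‖ ≤ C * Real.exp (m * W p)

/-- Sums of families `q(p) exp(-i t·ζ(p)) u(t - y(p))`. -/
inductive ShiftFamily (Ω : EuclideanSpace ℝ (Fin N) → ℝ) (W : P → ℝ)
    (y ζ : P → EuclideanSpace ℝ (Fin N)) : (P → EuclideanSpace ℝ (Fin N) → ℂ) → Prop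
  | base (q : P → ℂ) (u : EuclideanSpace ℝ (Fin N) → ℂ) (hc : Continuous q)
      (hq : ModerateGrowth W q) (hu : WeightedSmooth Ω u) :
      ShiftFamily Ω W y ζ
        (fun p t => q p * (Complex.exp (-(Complex.I * (inner ℝ t (ζ p) : ℝ))) * u (t - y p)))
  | add (ψ χ : P → EuclideanSpace ℝ (Fin N) → ℂ) (hψ : ShiftFamily Ω W y ζ ψ)
      (hχ : ShiftFamily Ω W y ζ χ) : ShiftFamily Ω W y ζ (fun p => ψ p + χ p)

lemma hasFDerivAt_phase (ξ t : EuclideanSpace ℝ (Fin N)) :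
    HasFDerivAt (fun t : EuclideanSpace ℝ (Fin N) =>
      Complex.exp (-(Complex.I * (inner ℝ t ξ : ℝ))))
      (Complex.exp (-(Complex.I * (inner ℝ t ξ : ℝ))) •
        (-(Complex.I • (Complex.ofRealCLM.comp (innerSL ℝ ξ))))) t := by
  have h0 : HasFDerivAt (fun t : EuclideanSpace ℝ (Fin N) => ((inner ℝ t ξ : ℝ) : ℂ))
      (Complex.ofRealCLM.comp (innerSL ℝ ξ)) t := by
    have := (Complex.ofRealCLM.comp (innerSL ℝ ξ)).hasFDerivAt (x := t)
    refine this.congr_of_eventuallyEq (Filter.Eventually.of_forall fun s => ?_)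
    simp [real_inner_comm]
  exact ((h0.const_mul Complex.I).neg).cexp

lemma contDiff_phase (ξ : EuclideanSpace ℝ (Fin N)) :
    ContDiff ℝ (⊤ : ℕ∞) (fun t : EuclideanSpace ℝ (Fin N) =>
      Complex.exp (-(Complex.I * (inner ℝ t ξ : ℝ)))) :=
  ((contDiff_const.mul
    (Complex.ofRealCLM.contDiff.comp (contDiff_id.inner ℝ contDiff_const))).neg).cexp

lemma norm_phase (r : ℝ) : ‖Complex.exp (-(Complex.I * (r : ℂ)))‖ = 1 := by
  rw [Complex.norm_exp]; simp

lemma pderiv_phase_mul_translate (j : Fin N) (y ξ : EuclideanSpace ℝ (Fin N))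
    {u : EuclideanSpace ℝ (Fin N) → ℂ} (hu : ContDiff ℝ (⊤ : ℕ∞) u) :
    pderiv j (fun t => Complex.exp (-(Complex.I * (inner ℝ t ξ : ℝ))) * u (t - y)) =
      fun t => Complex.exp (-(Complex.I * (inner ℝ t ξ : ℝ))) * pderiv j u (t - y) +
        -(ξ j : ℂ) * (Complex.exp (-(Complex.I * (inner ℝ t ξ : ℝ))) * u (t - y)) := by
  funext t
  have hd : DifferentiableAt ℝ (fun t => u (t - y)) t :=
    ((hu.comp (contDiff_id.sub contDiff_const)).differentiable (by simp)) t
  have h1 := ((hasFDerivAt_phase ξ t).mul hd.hasFDerivAt).fderiv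
  have hin : inner ℝ ξ (EuclideanSpace.single j (1 : ℝ)) = ξ j := by
    simp [EuclideanSpace.inner_single_right]
  rw [pderiv, show fderiv ℝ (fun t => Complex.exp (-(Complex.I * (inner ℝ t ξ : ℝ))) *
    u (t - y)) t = _ from h1]
  simp only [add_apply, smul_apply, neg_apply, ContinuousLinearMap.comp_apply,
    innerSL_apply_apply, hin, Complex.ofRealCLM_apply, smul_eq_mul, pderiv, fderiv_comp_sub]
  linear_combination (Complex.exp (-(Complex.I * (inner ℝ t ξ : ℝ))) * u (t - y) * (ξ j : ℂ)) *
    Complex.I_mul_I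

lemma ShiftFamily.contDiff {Ω : EuclideanSpace ℝ (Fin N) → ℝ} {W : P → ℝ}
    {y ζ : P → EuclideanSpace ℝ (Fin N)} {ψ : P → EuclideanSpace ℝ (Fin N) → ℂ}
    (h : ShiftFamily Ω W y ζ ψ) (p : P) : ContDiff ℝ (⊤ : ℕ∞) (ψ p) := by
  induction h with
  | base q u hc hq hu =>
    exact contDiff_const.mul ((contDiff_phase _).mul (hu.1.comp (contDiff_id.sub contDiff_const)))
  | add ψ χ _ _ h1 h2 => exact h1.add h2

lemma ShiftFamily.continuous {Ω : EuclideanSpace ℝ (Fin N) → ℝ} {W : P → ℝ}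
    {y ζ : P → EuclideanSpace ℝ (Fin N)} (hy : Continuous y) (hζ : Continuous ζ)
    {ψ : P → EuclideanSpace ℝ (Fin N) → ℂ} (h : ShiftFamily Ω W y ζ ψ) :
    Continuous fun r : P × EuclideanSpace ℝ (Fin N) => ψ r.1 r.2 := by
  induction h with
  | base q u hc hq hu => have := hu.1.continuous; fun_prop
  | add ψ χ _ _ h1 h2 => exact h1.add h2

/-- By the product rule, `D_j` of a basic family is a sum of two: one with `D_j u` in place of `u`,
and one in which the factor `-ζ_j` from the phase joins the coefficient, whose growth stays
moderate. This is why coefficients and sums belong to the class. -/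
lemma ShiftFamily.pderiv {Ω : EuclideanSpace ℝ (Fin N) → ℝ} {W : P → ℝ}
    {y ζ : P → EuclideanSpace ℝ (Fin N)} (hζ : Continuous ζ)
    (hζW : ∀ j, ModerateGrowth W (fun p => (ζ p j : ℂ))) (j : Fin N)
    {ψ : P → EuclideanSpace ℝ (Fin N) → ℂ} (h : ShiftFamily Ω W y ζ ψ) :
    ShiftFamily Ω W y ζ (fun p => Beurling.pderiv j (ψ p)) := by
  induction h with
  | base q u hc hq hu =>
    have h1 := ShiftFamily.base (y := y) (ζ := ζ) q _ hc hq (hu.pderiv j)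
    have h2 := ShiftFamily.base (y := y) (ζ := ζ) (fun p => q p * (ζ p j : ℂ)) _ (by fun_prop)
      (hq.mul (hζW j)) (hu.smul (-1))
    convert ShiftFamily.add _ _ h1 h2 using 2 with p
    have h3 := pderiv_smul j (q p) ((contDiff_phase (ζ p)).mul
      (hu.1.comp (contDiff_id.sub (contDiff_const (c := y p)))))
    refine Eq.trans h3 ?_
    have h4 := pderiv_phase_mul_translate j (y p) (ζ p) hu.1
    refine (congrArg (q p • ·) h4).trans ?_
    funext t
    simp only [Pi.smul_apply, smul_eq_mul, Pi.add_apply]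
    ring
  | add ψ χ h1 h2 ih1 ih2 =>
    convert ShiftFamily.add _ _ ih1 ih2 using 2 with p
    exact pderiv_add j (h1.contDiff p) (h2.contDiff p)

lemma ShiftFamily.bound {ω : Fin N → WeightFunction} {W : P → ℝ}
    {y ζ : P → EuclideanSpace ℝ (Fin N)} (hy : ∀ p, directSum ω (y p) ≤ W p)
    {ψ : P → EuclideanSpace ℝ (Fin N) → ℂ} (h : ShiftFamily (directSum ω) W y ζ ψ)
    (l : ℝ) (hl : 0 < l) : ∃ C m : ℝ, 0 ≤ C ∧
      ∀ p t, Real.exp (l * directSum ω t) * ‖ψ p t‖ ≤ C * Real.exp (m * W p) := by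
  have hW : ∀ p, 0 ≤ W p := fun p => (directSum_nonneg ω _).trans (hy p)
  induction h with
  | base q u hc hq hu =>
    obtain ⟨K, hK, hadd⟩ := directSum_add_le ω
    obtain ⟨A, m, hA0, hA⟩ := hq
    obtain ⟨B, hB⟩ := hu.bound (l * K) (by positivity)
    have hB0 := nonneg_of_exp_mul_norm_le hB
    -- From `Ω(t) ≤ K (1 + Ω(t - y) + Ω(y))` and `Ω(y) ≤ W`: the term in `t - y` is absorbed by the
    -- decay of `u`, the other two give `exp (l K)` and `exp (l K W)`.
    refine ⟨A * B * Real.exp (l * K), m + l * K, by positivity, fun p t => ?_⟩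
    rw [norm_mul, norm_mul, norm_phase, one_mul]
    have h1 := hadd (t - y p) (y p)
    rw [sub_add_cancel] at h1
    have h2 : l * directSum ω t ≤ l * K + l * K * W p + l * K * directSum ω (t - y p) := by
      have h3 := mul_le_mul_of_nonneg_left h1 hl.le
      have h4 := mul_le_mul_of_nonneg_left (hy p) (by positivity : 0 ≤ l * K)
      linarith
    calc Real.exp (l * directSum ω t) * (‖q p‖ * ‖u (t - y p)‖)
        ≤ Real.exp (l * K + l * K * W p + l * K * directSum ω (t - y p)) *
          ((A * Real.exp (m * W p)) * ‖u (t - y p)‖) := by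
          gcongr
          exact hA p
      _ = A * Real.exp (m * W p) * Real.exp (l * K) * Real.exp (l * K * W p) *
          (Real.exp (l * K * directSum ω (t - y p)) * ‖u (t - y p)‖) := by
          rw [Real.exp_add, Real.exp_add]; ring
      _ ≤ A * Real.exp (m * W p) * Real.exp (l * K) * Real.exp (l * K * W p) * B := by
          gcongr
          exact hB _
      _ = _ := by rw [add_mul, Real.exp_add]; ring
  | add ψ χ _ _ h1 h2 =>
    obtain ⟨A, m, hA0, hA⟩ := h1
    obtain ⟨B, n, hB0, hB⟩ := h2
    refine ⟨A + B, max m n, by positivity, fun p t => ?_⟩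
    calc Real.exp (l * directSum ω t) * ‖ψ p t + χ p t‖
        ≤ Real.exp (l * directSum ω t) * ‖ψ p t‖ + Real.exp (l * directSum ω t) * ‖χ p t‖ := by
          rw [← mul_add]; gcongr; exact norm_add_le _ _
      _ ≤ A * Real.exp (m * W p) + B * Real.exp (n * W p) := add_le_add (hA p t) (hB p t)
      _ ≤ A * Real.exp (max m n * W p) + B * Real.exp (max m n * W p) := by
          gcongr
          · exact hW p
          · exact le_max_left _ _
          · exact hW p
          · exact le_max_right _ _
      _ = _ := by ring

lemma ShiftFamily.goodFamily {ω : Fin N → WeightFunction} {W : P → ℝ}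
    {y ζ : P → EuclideanSpace ℝ (Fin N)} (hyc : Continuous y) (hζ : Continuous ζ)
    (hy : ∀ p, directSum ω (y p) ≤ W p)
    (hζW : ∀ j, ModerateGrowth W (fun p => (ζ p j : ℂ)))
    {ψ : P → EuclideanSpace ℝ (Fin N) → ℂ} (h : ShiftFamily (directSum ω) W y ζ ψ) :
    GoodFamily (directSum ω) W ψ := by
  have key : ∀ α, ShiftFamily (directSum ω) W y ζ (fun p => mderiv α (ψ p)) := fun α =>
    -- Only the family matters here; the single function is a dummy, taken to be `0`.
    mderiv_family_rel (R := fun _ ψ => ShiftFamily (directSum ω) W y ζ ψ)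
      (fun j _ ψ h => h.pderiv hζ hζW j) α (h := 0) h
  exact ⟨h.contDiff, fun α => (key α).continuous hyc hζ, fun α l hl => (key α).bound hy l hl⟩

lemma GoodFamily.pderiv {Ω : EuclideanSpace ℝ (Fin N) → ℝ} {W : P → ℝ}
    {ψ : P → EuclideanSpace ℝ (Fin N) → ℂ} (h : GoodFamily Ω W ψ) (j : Fin N) :
    GoodFamily Ω W (fun p => Beurling.pderiv j (ψ p)) := by
  have key : ∀ α, (fun p => mderiv α (Beurling.pderiv j (ψ p))) =
      fun p => mderiv (α + Pi.single j 1) (ψ p) := fun α =>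
    funext fun p => mderiv_pderiv α j (h.contDiff p)
  refine ⟨fun p => contDiff_pderiv j (h.contDiff p), fun α => ?_, fun α l hl => ?_⟩
  · simp only [mderiv_pderiv α j (h.contDiff _)]
    exact h.continuous _
  · simp only [mderiv_pderiv α j (h.contDiff _)]
    exact h.bound _ l hl

end Beurling

/-! ### Integrals of good families over the parameter. -/

namespace Beurling

open MeasureTheory

variable {N : ℕ} {P : Type*}

lemma RapidDecay.exists_integrable_bound [MeasurableSpace P] {μ : Measure P} {W : P → ℝ} (hW0 : ∀ p, 0 ≤ W p)
    (hμ : ∃ M : ℝ, 0 < M ∧ Integrable (fun p => Real.exp (-M * W p)) μ) {b : P → ℂ}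
    (hb : RapidDecay W b) (C m : ℝ) (hC : 0 ≤ C) :
    ∃ B : P → ℝ, Integrable B μ ∧ ∀ p, ‖b p‖ * (C * Real.exp (m * W p)) ≤ B p := by
  obtain ⟨M, hM, hi⟩ := hμ
  -- Of the decay `M + |m|`, the part `|m|` cancels the growth `exp (m W)` and `M` remains for
  -- integrability.
  obtain ⟨A, hA0, hA⟩ := hb (M + |m|) (by positivity)
  refine ⟨fun p => A * C * Real.exp (-M * W p), hi.const_mul _, fun p => ?_⟩
  calc ‖b p‖ * (C * Real.exp (m * W p))
      ≤ (A * Real.exp (-(M + |m|) * W p)) * (C * Real.exp (m * W p)) := by gcongr; exact hA p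
    _ = A * C * Real.exp (-(M + |m|) * W p + m * W p) := by rw [Real.exp_add]; ring
    _ ≤ A * C * Real.exp (-M * W p) := by
        refine mul_le_mul_of_nonneg_left (Real.exp_le_exp.2 ?_) (by positivity)
        nlinarith [mul_le_mul_of_nonneg_right (le_abs_self m) (hW0 p)]

variable [TopologicalSpace P]

/-- Continuity in the parameter for a weighted sup norm: outside a large ball a slightly stronger
weight makes both terms small, uniformly for `p` near `p₀`; on the ball joint continuity and
compactness suffice. -/
lemma GoodFamily.eventually_le {ω : Fin N → WeightFunction} {W : P → ℝ}
    {ψ : P → EuclideanSpace ℝ (Fin N) → ℂ} (h : GoodFamily (directSum ω) W ψ)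
    (hW : Continuous W) (α : Fin N → ℕ) {l : ℝ} (hl : 0 < l) (p₀ : P) {ε : ℝ} (hε : 0 < ε) :
    ∀ᶠ p in nhds p₀, ∀ t,
      Real.exp (l * directSum ω t) * ‖mderiv α (ψ p) t - mderiv α (ψ p₀) t‖ ≤ ε := by
  obtain ⟨C₀, k, hC₀, hk, hnorm⟩ := one_add_norm_le_exp ω
  -- The surplus weight `k` buys a factor `C₀ / (1 + ‖t‖)` in the tail.
  obtain ⟨C, m, hC, hbd⟩ := h.bound α (l + k) (by positivity)
  have hcont : Continuous fun p => C * Real.exp (m * W p) := by fun_prop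
  set A := C * Real.exp (m * W p₀) + 1 with hA
  have hA0 : 0 < A := by positivity
  have hev : ∀ᶠ p in nhds p₀, C * Real.exp (m * W p) < A :=
    hcont.continuousAt.eventually_lt continuousAt_const (by simp [hA])
  have tail : ∀ p, C * Real.exp (m * W p) < A → ∀ t,
      Real.exp (l * directSum ω t) * ‖mderiv α (ψ p) t‖ ≤ A * C₀ / (1 + ‖t‖) := by
    intro p hp t
    have h1 := (hbd p t).trans hp.le
    rw [add_mul, Real.exp_add] at h1
    rw [le_div_iff₀ (by positivity)]
    calc Real.exp (l * directSum ω t) * ‖mderiv α (ψ p) t‖ * (1 + ‖t‖)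
        ≤ Real.exp (l * directSum ω t) * ‖mderiv α (ψ p) t‖ *
          (C₀ * Real.exp (k * directSum ω t)) := by gcongr; exact hnorm t
      _ = Real.exp (l * directSum ω t) * Real.exp (k * directSum ω t) * ‖mderiv α (ψ p) t‖ * C₀ := by
          ring
      _ ≤ A * C₀ := by gcongr
  -- Beyond this radius the two tails, each at most `A * C₀ / (1 + ‖t‖)`, add up to at most `ε`.
  have hcomp : ∀ᶠ p in nhds p₀, ∀ t ∈ Metric.closedBall (0 : EuclideanSpace ℝ (Fin N))
      (2 * (A * C₀) / ε),
      Real.exp (l * directSum ω t) * ‖mderiv α (ψ p) t - mderiv α (ψ p₀) t‖ < ε := by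
    refine (isCompact_closedBall _ _).eventually_forall_of_forall_eventually fun t _ => ?_
    have hc : Continuous fun z : P × EuclideanSpace ℝ (Fin N) =>
        Real.exp (l * directSum ω z.2) * ‖mderiv α (ψ z.1) z.2 - mderiv α (ψ p₀) z.2‖ := by
      have h1 := h.continuous α
      have h2 : Continuous fun z : P × EuclideanSpace ℝ (Fin N) => mderiv α (ψ p₀) z.2 :=
        h1.comp (continuous_const.prodMk continuous_snd)
      have h3 := continuous_directSum ω
      exact (by fun_prop : Continuous fun z : P × EuclideanSpace ℝ (Fin N) =>
        Real.exp (l * directSum ω z.2)).mul (h1.sub h2).norm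
    exact hc.continuousAt.eventually_lt continuousAt_const (by simpa using hε)
  filter_upwards [hev, hcomp] with p h1 h2 t
  by_cases ht : t ∈ Metric.closedBall (0 : EuclideanSpace ℝ (Fin N)) (2 * (A * C₀) / ε)
  · exact (h2 t ht).le
  · rw [mem_closedBall_zero_iff, not_le, div_lt_iff₀ hε] at ht
    calc Real.exp (l * directSum ω t) * ‖mderiv α (ψ p) t - mderiv α (ψ p₀) t‖
        ≤ Real.exp (l * directSum ω t) * ‖mderiv α (ψ p) t‖ +
          Real.exp (l * directSum ω t) * ‖mderiv α (ψ p₀) t‖ := by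
          rw [← mul_add]; gcongr; exact norm_sub_le _ _
      _ ≤ A * C₀ / (1 + ‖t‖) + A * C₀ / (1 + ‖t‖) :=
          add_le_add (tail p h1 t) (tail p₀ (by simp [hA]) t)
      _ = 2 * (A * C₀) / (1 + ‖t‖) := by ring
      _ ≤ ε := by
          rw [div_le_iff₀ (by positivity)]
          nlinarith

lemma GoodFamily.continuous_apply {Ω : EuclideanSpace ℝ (Fin N) → ℝ} {W : P → ℝ}
    {ψ : P → EuclideanSpace ℝ (Fin N) → ℂ}
    (h : GoodFamily Ω W ψ) (t : EuclideanSpace ℝ (Fin N)) : Continuous fun p => ψ p t := by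
  have := (h.continuous 0).comp (continuous_id.prodMk (continuous_const (y := t)))
  simp only [mderiv_zero] at this
  exact this

variable [MeasurableSpace P] {μ : Measure P}

lemma GoodFamily.exists_dominating {ω : Fin N → WeightFunction} {W : P → ℝ} (hW0 : ∀ p, 0 ≤ W p)
    (hμ : ∃ M : ℝ, 0 < M ∧ Integrable (fun p => Real.exp (-M * W p)) μ) {b : P → ℂ}
    (hb : RapidDecay W b) {ψ : P → EuclideanSpace ℝ (Fin N) → ℂ}
    (h : GoodFamily (directSum ω) W ψ) (α : Fin N → ℕ) (l : ℝ) (hl : 0 < l) :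
    ∃ B : P → ℝ, Integrable B μ ∧
      ∀ p t, Real.exp (l * directSum ω t) * ‖b p * mderiv α (ψ p) t‖ ≤ B p := by
  obtain ⟨C, m, hC, hbd⟩ := h.bound α l hl
  obtain ⟨B, hB, hbB⟩ := hb.exists_integrable_bound hW0 hμ C m hC
  refine ⟨B, hB, fun p t => le_trans ?_ (hbB p)⟩
  rw [norm_mul, mul_left_comm]
  exact mul_le_mul_of_nonneg_left (hbd p t) (norm_nonneg _)

lemma GoodFamily.exists_dominating_zero {ω : Fin N → WeightFunction} {W : P → ℝ}
    (hW0 : ∀ p, 0 ≤ W p)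
    (hμ : ∃ M : ℝ, 0 < M ∧ Integrable (fun p => Real.exp (-M * W p)) μ) {b : P → ℂ}
    (hb : RapidDecay W b) {ψ : P → EuclideanSpace ℝ (Fin N) → ℂ}
    (h : GoodFamily (directSum ω) W ψ) :
    ∃ B : P → ℝ, Integrable B μ ∧ ∀ p t, ‖b p * ψ p t‖ ≤ B p := by
  obtain ⟨B, hB, hbB⟩ := h.exists_dominating hW0 hμ hb 0 1 one_pos
  refine ⟨B, hB, fun p t => le_trans ?_ (hbB p t)⟩
  rw [mderiv_zero]
  exact le_mul_of_one_le_left (norm_nonneg _)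
    (Real.one_le_exp (by have := directSum_nonneg ω t; positivity))

variable [OpensMeasurableSpace P]

lemma GoodFamily.hasFDerivAt_integral {ω : Fin N → WeightFunction} {W : P → ℝ}
    (hW0 : ∀ p, 0 ≤ W p)
    (hμ : ∃ M : ℝ, 0 < M ∧ Integrable (fun p => Real.exp (-M * W p)) μ) {b : P → ℂ}
    (hbc : Continuous b) (hb : RapidDecay W b) {ψ : P → EuclideanSpace ℝ (Fin N) → ℂ}
    (h : GoodFamily (directSum ω) W ψ) (t : EuclideanSpace ℝ (Fin N)) :
    HasFDerivAt (fun t => ∫ p, b p * ψ p t ∂μ)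
      (∑ j, (Complex.I * ∫ p, b p * Beurling.pderiv j (ψ p) t ∂μ) • coordCLM j) t := by
  choose B hB hbB using fun j => (h.pderiv j).exists_dominating_zero hW0 hμ hb
  obtain ⟨B₀, hB₀, hbB₀⟩ := h.exists_dominating_zero hW0 hμ hb
  have hm : ∀ t, AEStronglyMeasurable (fun p => b p * ψ p t) μ := fun t =>
    (hbc.mul (h.continuous_apply t)).aestronglyMeasurable
  have hmj : ∀ j t, AEStronglyMeasurable (fun p => b p * Beurling.pderiv j (ψ p) t) μ := fun j t =>
    (hbc.mul ((h.pderiv j).continuous_apply t)).aestronglyMeasurable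
  have hij : ∀ j, Integrable (fun p => b p * Beurling.pderiv j (ψ p) t) μ := fun j =>
    (hB j).mono' (hmj j t) (Filter.Eventually.of_forall fun p => hbB j p t)
  -- The dominating functions `B j` do not depend on `t`, so the neighbourhood of `t` can be the
  -- whole space.
  have key := hasFDerivAt_integral_of_dominated_of_fderiv_le (μ := μ) (𝕜 := ℝ)
    (F := fun t p => b p * ψ p t) (x₀ := t) (s := Set.univ)
    (F' := fun t p => ∑ j, (Complex.I * (b p * Beurling.pderiv j (ψ p) t)) • coordCLM j)
    (bound := fun p => ∑ j, B j p * ‖coordCLM (N := N) j‖) Filter.univ_mem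
    (Filter.Eventually.of_forall hm)
    (hB₀.mono' (hm t) (Filter.Eventually.of_forall fun p => hbB₀ p t))
    (Finset.aestronglyMeasurable_fun_sum _ fun j _ =>
      ((hmj j t).const_mul _).smul_const _)
    (Filter.Eventually.of_forall fun p t _ => by
      refine (norm_sum_le _ _).trans (Finset.sum_le_sum fun j _ => ?_)
      rw [norm_smul, norm_mul, Complex.norm_I, one_mul]
      gcongr
      exact hbB j p t)
    (integrable_finsetSum _ fun j _ => (hB j).mul_const _)
    (Filter.Eventually.of_forall fun p t _ => by
      have h1 := ((h.contDiff p).differentiable (by simp) t).hasFDerivAt.const_mul (b p)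
      have h2 : ∑ j, (Complex.I * (b p * Beurling.pderiv j (ψ p) t)) • coordCLM j =
          b p • fderiv ℝ (ψ p) t := by
        rw [fderiv_eq_sum_pderiv, Finset.smul_sum]
        refine Finset.sum_congr rfl fun j _ => ?_
        rw [smul_smul, mul_left_comm]
      rw [h2]
      exact h1)
  have h3 : ∑ j, (Complex.I * ∫ p, b p * Beurling.pderiv j (ψ p) t ∂μ) • coordCLM j =
      ∫ p, ∑ j, (Complex.I * (b p * Beurling.pderiv j (ψ p) t)) • coordCLM j ∂μ := by
    rw [integral_finsetSum _ fun j _ => ((hij j).const_mul _).smul_const _]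
    refine Finset.sum_congr rfl fun j _ => ?_
    rw [integral_smul_const, integral_const_mul]
  rw [h3]
  exact key

lemma GoodFamily.pderiv_integral {ω : Fin N → WeightFunction} {W : P → ℝ}
    (hW0 : ∀ p, 0 ≤ W p)
    (hμ : ∃ M : ℝ, 0 < M ∧ Integrable (fun p => Real.exp (-M * W p)) μ) {b : P → ℂ}
    (hbc : Continuous b) (hb : RapidDecay W b) {ψ : P → EuclideanSpace ℝ (Fin N) → ℂ}
    (h : GoodFamily (directSum ω) W ψ) (j : Fin N) :
    Beurling.pderiv j (fun t => ∫ p, b p * ψ p t ∂μ) =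
      fun t => ∫ p, b p * Beurling.pderiv j (ψ p) t ∂μ := by
  funext t
  rw [Beurling.pderiv, (h.hasFDerivAt_integral hW0 hμ hbc hb t).fderiv, FunLike.coe_sum,
    Finset.sum_apply, Finset.sum_eq_single j]
  · simp [coordCLM, ← mul_assoc]
  · intro i _ hi
    simp [coordCLM, hi]
  · simp

lemma GoodFamily.mderiv_integral {ω : Fin N → WeightFunction} {W : P → ℝ}
    (hW0 : ∀ p, 0 ≤ W p)
    (hμ : ∃ M : ℝ, 0 < M ∧ Integrable (fun p => Real.exp (-M * W p)) μ) {b : P → ℂ}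
    (hbc : Continuous b) (hb : RapidDecay W b) {ψ : P → EuclideanSpace ℝ (Fin N) → ℂ}
    (h : GoodFamily (directSum ω) W ψ) (α : Fin N → ℕ) :
    mderiv α (fun t => ∫ p, b p * ψ p t ∂μ) = fun t => ∫ p, b p * mderiv α (ψ p) t ∂μ := by
  refine (mderiv_family_rel (R := fun k ψ => GoodFamily (directSum ω) W ψ ∧
    k = fun t => ∫ p, b p * ψ p t ∂μ) ?_ α ⟨h, rfl⟩).2
  rintro j _ ψ ⟨hψ, rfl⟩
  exact ⟨hψ.pderiv j, hψ.pderiv_integral hW0 hμ hbc hb j⟩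

lemma GoodFamily.weightedSmooth_integral {ω : Fin N → WeightFunction} {W : P → ℝ}
    (hW0 : ∀ p, 0 ≤ W p)
    (hμ : ∃ M : ℝ, 0 < M ∧ Integrable (fun p => Real.exp (-M * W p)) μ) {b : P → ℂ}
    (hbc : Continuous b) (hb : RapidDecay W b) {ψ : P → EuclideanSpace ℝ (Fin N) → ℂ}
    (h : GoodFamily (directSum ω) W ψ) :
    WeightedSmooth (directSum ω) (fun t => ∫ p, b p * ψ p t ∂μ) := by
  -- With `b` fixed, the integrals of all good families form a set stable under each `D_j`, as `D_j`
  -- passes under the integral.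
  refine ⟨contDiff_of_stable (T := {k | ∃ χ, GoodFamily (directSum ω) W χ ∧
    k = fun t => ∫ p, b p * χ p t ∂μ}) ?_ ?_ ⟨ψ, h, rfl⟩, fun l hl α => ?_⟩
  · rintro _ ⟨χ, hχ, rfl⟩ t
    exact (hχ.hasFDerivAt_integral hW0 hμ hbc hb t).differentiableAt
  · rintro j _ ⟨χ, hχ, rfl⟩
    exact ⟨_, hχ.pderiv j, hχ.pderiv_integral hW0 hμ hbc hb j⟩
  · obtain ⟨B, hB, hbB⟩ := h.exists_dominating hW0 hμ hb α l hl
    refine ⟨∫ p, B p ∂μ, fun t => ?_⟩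
    rw [h.mderiv_integral hW0 hμ hbc hb α]
    calc Real.exp (l * directSum ω t) * ‖∫ p, b p * mderiv α (ψ p) t ∂μ‖
        ≤ Real.exp (l * directSum ω t) * ∫ p, ‖b p * mderiv α (ψ p) t‖ ∂μ := by
          gcongr; exact norm_integral_le_integral_norm _
      _ = ∫ p, Real.exp (l * directSum ω t) * ‖b p * mderiv α (ψ p) t‖ ∂μ :=
          (integral_const_mul _ _).symm
      _ ≤ ∫ p, B p ∂μ :=
          integral_mono_of_nonneg (Filter.Eventually.of_forall fun p => by positivity) hB
            (Filter.Eventually.of_forall fun p => hbB p t)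

end Beurling

/-! ### Fourier inversion, Parseval, and time-frequency shifts as good families. -/

namespace Beurling

open MeasureTheory FourierTransform

variable {N : ℕ}

lemma fourierT_two_pi_smul (f : EuclideanSpace ℝ (Fin N) → ℂ) (w : EuclideanSpace ℝ (Fin N)) :
    fourierT f ((2 * Real.pi) • w) = 𝓕 f w := by
  rw [Real.fourier_eq', fourierT]
  congr 1
  funext v
  rw [inner_smul_right, smul_eq_mul]
  congr 2
  push_cast
  ring

/-- Fourier inversion in the normalization of `fourierT`. -/
lemma integral_exp_mul_fourierT {f : EuclideanSpace ℝ (Fin N) → ℂ} (hc : Continuous f)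
    (hf : Integrable f) (hf' : Integrable (fourierT f)) (t : EuclideanSpace ℝ (Fin N)) :
    ∫ η, Complex.exp (Complex.I * (inner ℝ η t : ℝ)) * fourierT f η =
      (2 * Real.pi : ℂ) ^ N * f t := by
  have hpi : (2 * Real.pi) ≠ 0 := by positivity
  have h1 : Integrable (𝓕 f) := by
    have := hf'.comp_smul hpi
    simpa only [fourierT_two_pi_smul] using this
  have h2 := congrFun (hc.fourierInv_fourier_eq hf h1) t
  rw [Real.fourierInv_eq'] at h2
  -- The substitution `η = 2π w` passes between the two normalizations; its Jacobian is the source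
  -- of `(2π)^N`.
  have h3 := Measure.integral_comp_smul (volume : Measure (EuclideanSpace ℝ (Fin N)))
    (fun η => Complex.exp (Complex.I * (inner ℝ η t : ℝ)) * fourierT f η) (2 * Real.pi)
  have h4 : (fun w => Complex.exp (Complex.I * (inner ℝ ((2 * Real.pi) • w) t : ℝ)) *
      fourierT f ((2 * Real.pi) • w)) =
      fun w => Complex.exp (((2 * Real.pi * inner ℝ w t : ℝ) : ℂ) * Complex.I) • 𝓕 f w := by
    funext w
    rw [fourierT_two_pi_smul, real_inner_smul_left, smul_eq_mul, mul_comm Complex.I]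
  rw [h4, h2, finrank_euclideanSpace_fin, abs_of_pos (by positivity), Complex.real_smul] at h3
  rw [h3, ← mul_assoc]
  push_cast
  rw [mul_inv_cancel₀ (pow_ne_zero _ (by exact_mod_cast hpi)), one_mul]

/-- Parseval's formula. -/
lemma integral_mul_eq_integral_fourierT {h φ : EuclideanSpace ℝ (Fin N) → ℂ} (hc : Continuous h)
    (hh : Integrable h) (hh' : Integrable (fourierT h)) (hφ : Integrable φ) :
    (2 * Real.pi : ℂ) ^ N * ∫ t, h t * φ t = ∫ η, fourierT h η * fourierT φ (-η) := by
  have hi : Integrable (Function.uncurry fun t η : EuclideanSpace ℝ (Fin N) =>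
      Complex.exp (Complex.I * (inner ℝ η t : ℝ)) * (φ t * fourierT h η))
      (volume.prod volume) := by
    refine (hφ.mul_prod hh').bdd_mul (c := 1) (Continuous.aestronglyMeasurable (by fun_prop))
      (Filter.Eventually.of_forall fun z => le_of_eq ?_)
    rw [Complex.norm_exp]
    simp
  rw [← integral_const_mul]
  calc ∫ t, (2 * Real.pi : ℂ) ^ N * (h t * φ t)
      = ∫ t, ∫ η, Complex.exp (Complex.I * (inner ℝ η t : ℝ)) * (φ t * fourierT h η) := by
        congr 1
        funext t
        rw [← mul_assoc, ← integral_exp_mul_fourierT hc hh hh' t, ← integral_mul_const]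
        congr 1
        funext η
        ring
    _ = ∫ η, ∫ t, Complex.exp (Complex.I * (inner ℝ η t : ℝ)) * (φ t * fourierT h η) :=
        integral_integral_swap hi
    _ = _ := by
        congr 1
        funext η
        rw [fourierT.eq_def φ, ← integral_const_mul]
        congr 1
        funext t
        rw [inner_neg_right, real_inner_comm]
        push_cast
        rw [mul_neg, neg_neg]
        ring

variable {ω σ : Fin N → WeightFunction}

lemma Space.continuous (g : Space ω σ) : Continuous g := g.2.2.1.1.continuous

lemma Space.integrable (g : Space ω σ) : Integrable (g : EuclideanSpace ℝ (Fin N) → ℂ) := g.2.1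

lemma Space.ext {g h : Space ω σ} (H : ∀ t, g t = h t) : g = h := Subtype.ext (funext H)

lemma Space.integrable_fourierT (g : Space ω σ) : Integrable (fourierT g) := g.2.2.2.integrable

/-- The index `(0, 0)` stands for `‖exp(Ω) φ‖_∞`, which dominates the sup norm since `Ω ≥ 0`. -/
lemma Space.norm_le_seminorm (φ : Space ω σ) (t : EuclideanSpace ℝ (Fin N)) :
    ‖φ t‖ ≤ seminorms ω σ (Sum.inl (0, 0)) φ := by
  have h1 := le_ciSup (bddAbove_of_weightedSmooth φ.2.2.1 0 0) t
  refine le_trans ?_ h1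
  simp only [mderiv_zero]
  exact le_mul_of_one_le_left (norm_nonneg _)
    (Real.one_le_exp (by have := directSum_nonneg ω t; positivity))

lemma Space.integrable_mul (h φ : Space ω σ) : Integrable fun t => h t * φ t :=
  h.integrable.mul_bdd (c := seminorms ω σ (Sum.inl (0, 0)) φ) φ.continuous.aestronglyMeasurable
    (Filter.Eventually.of_forall φ.norm_le_seminorm)

/-- The linear form `φ ↦ ∫ h φ`. -/
noncomputable def Space.integralForm (h : Space ω σ) : Space ω σ →ₗ[ℂ] ℂ where
  toFun φ := ∫ t, h t * φ t
  map_add' φ χ := by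
    rw [← integral_add (h.integrable_mul φ) (h.integrable_mul χ)]
    congr 1
    funext t
    exact mul_add _ _ _
  map_smul' c φ := by
    rw [RingHom.id_apply, smul_eq_mul, ← integral_const_mul]
    congr 1
    funext t
    exact mul_left_comm _ _ _

/-- The ultradistribution `φ ↦ ∫ h φ`. -/
noncomputable def Space.toUltradistribution (h : Space ω σ) : Ultradistribution ω σ where
  toLinearMap := h.integralForm
  cont := by
    refine (withSeminorms ω σ).continuous_normedSpace_rng ℂ h.integralForm
      ⟨{Sum.inl (0, 0)}, ⟨∫ t, ‖h t‖, integral_nonneg fun t => norm_nonneg _⟩, fun φ => ?_⟩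
    simp only [Finset.sup_singleton]
    change ‖∫ t, h t * φ t‖ ≤ (∫ t, ‖h t‖) * seminorms ω σ (Sum.inl (0, 0)) φ
    rw [← integral_mul_const]
    refine norm_integral_le_of_norm_le (h.integrable.norm.mul_const _)
      (Filter.Eventually.of_forall fun t => ?_)
    rw [norm_mul]
    exact mul_le_mul_of_nonneg_left (φ.norm_le_seminorm t) (norm_nonneg _)

/-- The complex conjugate of an element of `S_Ω^Σ`. -/
noncomputable def Space.conj (g : Space ω σ) : Space ω σ :=
  ⟨fun t => (starRingEnd ℂ) (g t), Complex.conjCLE.toContinuousLinearMap.integrable_comp g.2.1,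
    g.2.2.1.conj, by rw [fourierT_conj]; exact g.2.2.2.reflect.conj⟩

/-- The Fourier transform exchanges translation and modulation. The result is again a time-frequency
shift, centred at `-ξ` with frequency `x`, up to a unimodular factor depending on `(x, ξ)` only. -/
lemma fourierT_conjShift (g : Space ω σ) (x ξ η : EuclideanSpace ℝ (Fin N)) :
    fourierT (conjShift g x ξ) η = Complex.exp (-(Complex.I * (inner ℝ ξ x : ℝ))) *
      (Complex.exp (-(Complex.I * (inner ℝ η x : ℝ))) *
        (starRingEnd ℂ) (fourierT g (-(η - -ξ)))) := by
  change fourierT (fun t => Complex.exp (-(Complex.I * (inner ℝ t ξ : ℝ))) *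
    (fun s => (starRingEnd ℂ) ((fun r => g (r - x)) s)) t) η = _
  rw [fourierT_modulate, fourierT_conj, fourierT_translate]
  simp only [map_mul, ← Complex.exp_conj]
  rw [← mul_assoc, ← Complex.exp_add]
  congr 2
  simp only [map_neg, map_mul, Complex.conj_I, Complex.conj_ofReal, inner_neg_left, inner_sub_left]
  push_cast
  ring

/-- The weight `Ω ⊕ Σ` on phase space. -/
noncomputable def phaseWeight (ω σ : Fin N → WeightFunction)
    (p : EuclideanSpace ℝ (Fin N) × EuclideanSpace ℝ (Fin N)) : ℝ :=
  directSum ω p.1 + directSum σ p.2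

lemma continuous_phaseWeight (ω σ : Fin N → WeightFunction) : Continuous (phaseWeight ω σ) :=
  ((continuous_directSum ω).comp continuous_fst).add ((continuous_directSum σ).comp continuous_snd)

lemma phaseWeight_nonneg (ω σ : Fin N → WeightFunction)
    (p : EuclideanSpace ℝ (Fin N) × EuclideanSpace ℝ (Fin N)) : 0 ≤ phaseWeight ω σ p :=
  add_nonneg (directSum_nonneg _ _) (directSum_nonneg _ _)

lemma integrable_exp_neg_phaseWeight (ω σ : Fin N → WeightFunction) :
    ∃ M : ℝ, 0 < M ∧ Integrable (fun p => Real.exp (-M * phaseWeight ω σ p)) := by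
  obtain ⟨M, hM, hi⟩ := integrable_exp_neg_directSum ω
  obtain ⟨M', hM', hi'⟩ := integrable_exp_neg_directSum σ
  refine ⟨max M M', lt_max_of_lt_left hM, (hi.mul_prod hi').mono' ?_
    (Filter.Eventually.of_forall fun p => ?_)⟩
  · have := continuous_phaseWeight ω σ
    exact Continuous.aestronglyMeasurable (by fun_prop)
  · rw [Real.norm_eq_abs, abs_of_pos (Real.exp_pos _), ← Real.exp_add, Real.exp_le_exp, phaseWeight]
    have h1 := mul_le_mul_of_nonneg_right (le_max_left M M') (directSum_nonneg ω p.1)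
    have h2 := mul_le_mul_of_nonneg_right (le_max_right M M') (directSum_nonneg σ p.2)
    linarith

lemma moderateGrowth_coord {P : Type*} {W : P → ℝ} {ζ : P → EuclideanSpace ℝ (Fin N)}
    (hζ : ∀ p, directSum ω (ζ p) ≤ W p) (j : Fin N) :
    ModerateGrowth W (fun p => (ζ p j : ℂ)) := by
  obtain ⟨C, k, hC, hk, h⟩ := one_add_norm_le_exp ω
  refine ⟨C, k, hC.le, fun p => ?_⟩
  rw [Complex.norm_real]
  have h1 := PiLp.norm_apply_le (ζ p) j
  calc ‖ζ p j‖ ≤ 1 + ‖ζ p‖ := by linarith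
    _ ≤ C * Real.exp (k * directSum ω (ζ p)) := h _
    _ ≤ C * Real.exp (k * W p) := by gcongr; exact hζ p

/-- The phase-space weight controls both parameters: `Ω(x)` bounds the effect of translation, and
the powers of `ξ` produced by differentiation are bounded by powers of `exp Σ(ξ)`. On the Fourier
side the roles of `x` and `ξ` are exchanged. -/
lemma goodFamily_conjShift (g : Space ω σ) : GoodFamily (directSum ω) (phaseWeight ω σ)
    (fun p => (conjShift g p.1 p.2 : EuclideanSpace ℝ (Fin N) → ℂ)) := by
  refine ShiftFamily.goodFamily (y := Prod.fst) (ζ := Prod.snd) continuous_fst continuous_snd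
    (fun p => le_add_of_nonneg_right (directSum_nonneg _ _))
    (moderateGrowth_coord (ω := σ) fun p => le_add_of_nonneg_left (directSum_nonneg _ _)) ?_
  convert ShiftFamily.base (y := Prod.fst) (ζ := Prod.snd) (fun _ => (1 : ℂ)) _ continuous_const
    ⟨1, 0, zero_le_one, fun p => by simp⟩ g.2.2.1.conj using 3 with p t
  exact (one_mul _).symm

lemma goodFamily_fourierT_conjShift (g : Space ω σ) :
    GoodFamily (directSum σ) (phaseWeight ω σ) (fun p => fourierT (conjShift g p.1 p.2)) := by
  refine ShiftFamily.goodFamily (y := fun p => -p.2) (ζ := Prod.fst) (by fun_prop) continuous_fst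
    (fun p => by rw [directSum_neg]; exact le_add_of_nonneg_left (directSum_nonneg _ _))
    (moderateGrowth_coord (ω := ω) fun p => le_add_of_nonneg_right (directSum_nonneg _ _)) ?_
  convert ShiftFamily.base (y := fun p => -p.2) (ζ := Prod.fst)
    (fun p : EuclideanSpace ℝ (Fin N) × EuclideanSpace ℝ (Fin N) =>
      Complex.exp (-(Complex.I * (inner ℝ p.2 p.1 : ℝ)))) _ (by fun_prop)
    ⟨1, 0, zero_le_one, fun p => by simp [norm_phase]⟩ g.2.2.2.reflect.conj using 3 with p t
  exact fourierT_conjShift g _ _ _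

lemma mderiv_sub (α : Fin N → ℕ) {f g : EuclideanSpace ℝ (Fin N) → ℂ}
    (hf : ContDiff ℝ (⊤ : ℕ∞) f) (hg : ContDiff ℝ (⊤ : ℕ∞) g) :
    mderiv α (f - g) = mderiv α f - mderiv α g := by
  have h1 : f - g = f + (-1 : ℂ) • g := by rw [neg_one_smul, sub_eq_add_neg]
  have h2 : ContDiff ℝ (⊤ : ℕ∞) ((-1 : ℂ) • g) := contDiff_const.smul hg
  rw [h1, mderiv_add α hf h2, mderiv_smul α _ hg, neg_one_smul,
    sub_eq_add_neg]

lemma fourierT_sub {f g : EuclideanSpace ℝ (Fin N) → ℂ} (hf : Integrable f) (hg : Integrable g) :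
    fourierT (f - g) = fourierT f - fourierT g := by
  have h1 : f - g = f + (-1 : ℂ) • g := by rw [neg_one_smul, sub_eq_add_neg]
  rw [h1, fourierT_add hf (hg.smul _), fourierT_smul, neg_one_smul, sub_eq_add_neg]

lemma GoodFamily.eventually_weightedSup_lt {P : Type*} [TopologicalSpace P] {W : P → ℝ}
    {ψ : P → EuclideanSpace ℝ (Fin N) → ℂ} (h : GoodFamily (directSum ω) W ψ)
    (hW : Continuous W) (n : ℕ) (α : Fin N → ℕ) (p₀ : P) {ε : ℝ} (hε : 0 < ε) :
    ∀ᶠ p in nhds p₀, weightedSup (directSum ω) n α (ψ p - ψ p₀) < ε := by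
  filter_upwards [h.eventually_le hW α (by positivity : 0 < (n : ℝ) + 1) p₀ (half_pos hε)]
    with p hp
  refine (ciSup_le fun t => ?_).trans_lt (half_lt_self hε)
  rw [mderiv_sub α (h.contDiff p) (h.contDiff p₀)]
  exact hp t

/-- Each seminorm of either kind is a weighted sup norm of a good family. Consequently `V_g f` is
continuous for every ultradistribution `f`, and the integrands in the Bochner integrals below are
measurable. -/
lemma continuous_conjShift (g : Space ω σ) :
    Continuous fun p : EuclideanSpace ℝ (Fin N) × EuclideanSpace ℝ (Fin N) =>
      conjShift g p.1 p.2 := by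
  refine continuous_iff_continuousAt.2 fun p₀ => ?_
  refine ((withSeminorms ω σ).tendsto_nhds _ _).2 ?_
  rintro (⟨n, α⟩ | ⟨n, α⟩) ε hε
  · exact (goodFamily_conjShift g).eventually_weightedSup_lt (continuous_phaseWeight ω σ) n α p₀ hε
  · filter_upwards [(goodFamily_fourierT_conjShift g).eventually_weightedSup_lt
      (continuous_phaseWeight ω σ) n α p₀ hε] with p hp
    rw [← fourierT_sub (Space.integrable _) (Space.integrable _)] at hp
    exact hp

end Beurling

/-! ### Decay of time-frequency correlations. -/

namespace Beurling

open MeasureTheory BoundedContinuousFunction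

variable {N : ℕ} {ω σ : Fin N → WeightFunction}

/-- Time-frequency correlations of elements of `S_Ω^Σ` decrease rapidly. -/
lemma rapidDecay_integral_mul_conjShift (h g : Space ω σ) :
    RapidDecay (phaseWeight ω σ) (fun p => ∫ t, h t * conjShift g p.1 p.2 t) := by
  intro l hl
  -- The rate is `2 * l` because a geometric mean of the two bounds will halve it.
  obtain ⟨A, hA0, hA⟩ := integral_norm_mul_norm_sub_le (ω := ω)
    (fun l hl => h.2.2.1.bound l hl) (fun l hl => g.2.2.1.bound l hl) (2 * l) (by positivity)
  obtain ⟨B, hB0, hB⟩ := integral_norm_mul_norm_sub_le (ω := σ)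
    (fun l hl => h.2.2.2.bound l hl) (fun l hl => g.2.2.2.bound l hl) (2 * l) (by positivity)
  refine ⟨A + B, by positivity, fun ⟨x, ξ⟩ => ?_⟩
  set v := ∫ t, h t * conjShift g x ξ t with hv
  have h1 : ‖v‖ ≤ A * Real.exp (-(2 * l) * directSum ω x) := by
    refine (norm_integral_le_integral_norm _).trans (le_trans (le_of_eq ?_) (hA x))
    congr 1
    funext t
    rw [norm_mul, conjShift, norm_mul, norm_phase, one_mul, RCLike.norm_conj]
  have h2 : ‖v‖ ≤ B * Real.exp (-(2 * l) * directSum σ ξ) := by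
    -- As `(2π)^N ≥ 1`, the constant in Parseval's formula can be dropped from the estimate.
    have hpi : (1 : ℝ) ≤ (2 * Real.pi) ^ N := one_le_pow₀ (by linarith [Real.two_le_pi])
    have h3 := integral_mul_eq_integral_fourierT h.continuous h.integrable h.integrable_fourierT
      (conjShift g x ξ).integrable
    calc ‖v‖ ≤ (2 * Real.pi) ^ N * ‖v‖ := le_mul_of_one_le_left (norm_nonneg _) hpi
      _ = ‖(2 * Real.pi : ℂ) ^ N * v‖ := by
          rw [norm_mul, norm_pow, norm_mul, Complex.norm_real, Complex.norm_ofNat, Real.norm_eq_abs,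
            abs_of_pos Real.pi_pos]
      _ = ‖∫ η, fourierT h η * fourierT (conjShift g x ξ) (-η)‖ := by rw [hv, h3]
      _ ≤ ∫ η, ‖fourierT h η * fourierT (conjShift g x ξ) (-η)‖ :=
          norm_integral_le_integral_norm _
      _ = ∫ η, ‖fourierT h η‖ * ‖fourierT g (η - ξ)‖ := by
          congr 1
          funext η
          rw [norm_mul, fourierT_conjShift, norm_mul, norm_mul, norm_phase, norm_phase, one_mul,
            one_mul, RCLike.norm_conj]
          congr 3
          abel
      _ ≤ _ := hB ξ
  -- The product of the two bounds controls `‖v‖ ^ 2`; the inequality `A * B ≤ (A + B) ^ 2` avoids a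
  -- square root in the constant.
  refine (pow_le_pow_iff_left₀ (norm_nonneg _) (by positivity) two_ne_zero).1 ?_
  have hexp : Real.exp (-(2 * l) * directSum ω x) * Real.exp (-(2 * l) * directSum σ ξ) =
      Real.exp (-l * phaseWeight ω σ (x, ξ)) ^ 2 := by
    rw [← Real.exp_add, ← Real.exp_nat_mul, phaseWeight]
    congr 1
    push_cast
    ring
  calc ‖v‖ ^ 2 = ‖v‖ * ‖v‖ := sq _
    _ ≤ (A * Real.exp (-(2 * l) * directSum ω x)) * (B * Real.exp (-(2 * l) * directSum σ ξ)) := by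
        gcongr
    _ = A * B * Real.exp (-l * phaseWeight ω σ (x, ξ)) ^ 2 := by rw [← hexp]; ring
    _ ≤ (A + B) ^ 2 * Real.exp (-l * phaseWeight ω σ (x, ξ)) ^ 2 := by
        gcongr
        nlinarith
    _ = _ := (mul_pow _ _ _).symm

/-! ### Weak integrals in `S_Ω^Σ` -/

/-- `exp((n+1)Ω) D^α f` as a bounded continuous function. -/
noncomputable def WeightedSmooth.toBCF {f : EuclideanSpace ℝ (Fin N) → ℂ}
    (hf : WeightedSmooth (directSum ω) f) (n : ℕ) (α : Fin N → ℕ) :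
    EuclideanSpace ℝ (Fin N) →ᵇ ℂ :=
  ofNormedAddCommGroup (fun x => (Real.exp (((n : ℝ) + 1) * directSum ω x) : ℂ) * mderiv α f x)
    (by
      have h1 := continuous_directSum ω
      have h2 : ContDiff ℝ (⊤ : ℕ∞) (mderiv α f) :=
        mderiv_mem (T := {f | ContDiff ℝ (⊤ : ℕ∞) f}) (fun j f hf => contDiff_pderiv j hf) α hf.1
      have h3 := h2.continuous
      fun_prop)
    (weightedSup (directSum ω) n α f) fun x => by
      rw [norm_mul, Complex.norm_real, Real.norm_eq_abs, abs_of_pos (Real.exp_pos _)]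
      exact le_ciSup (bddAbove_of_weightedSmooth hf n α) x

lemma WeightedSmooth.toBCF_apply {f : EuclideanSpace ℝ (Fin N) → ℂ}
    (hf : WeightedSmooth (directSum ω) f) (n : ℕ) (α : Fin N → ℕ) (x : EuclideanSpace ℝ (Fin N)) :
    hf.toBCF n α x = (Real.exp (((n : ℝ) + 1) * directSum ω x) : ℂ) * mderiv α f x := rfl

lemma WeightedSmooth.norm_toBCF {f : EuclideanSpace ℝ (Fin N) → ℂ}
    (hf : WeightedSmooth (directSum ω) f) (n : ℕ) (α : Fin N → ℕ) :
    ‖hf.toBCF n α‖ = weightedSup (directSum ω) n α f := by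
  refine le_antisymm (norm_ofNormedAddCommGroup_le _
    (Real.iSup_nonneg fun x => by positivity) _) (ciSup_le fun x => ?_)
  have := (hf.toBCF n α).norm_coe_le_norm x
  rwa [hf.toBCF_apply, norm_mul, Complex.norm_real, Real.norm_eq_abs,
    abs_of_pos (Real.exp_pos _)] at this

lemma WeightedSmooth.toBCF_add {f g k : EuclideanSpace ℝ (Fin N) → ℂ}
    (hf : WeightedSmooth (directSum ω) f) (hg : WeightedSmooth (directSum ω) g)
    (hk : WeightedSmooth (directSum ω) k) (H : k = f + g) (n : ℕ) (α : Fin N → ℕ) :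
    hk.toBCF n α = hf.toBCF n α + hg.toBCF n α := by
  subst H
  ext x
  rw [BoundedContinuousFunction.add_apply]
  simp only [toBCF_apply, mderiv_add α hf.1 hg.1, Pi.add_apply, mul_add]

lemma WeightedSmooth.toBCF_smul (c : ℂ) {f k : EuclideanSpace ℝ (Fin N) → ℂ}
    (hf : WeightedSmooth (directSum ω) f)
    (hk : WeightedSmooth (directSum ω) k) (H : k = c • f) (n : ℕ) (α : Fin N → ℕ) :
    hk.toBCF n α = c • hf.toBCF n α := by
  subst H
  ext x
  rw [BoundedContinuousFunction.smul_apply]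
  simp only [toBCF_apply, mderiv_smul α c hf.1, Pi.smul_apply, smul_eq_mul, mul_left_comm]

/-- The linear map inducing the `i`-th seminorm of `S_Ω^Σ`. -/
noncomputable def component (ω σ : Fin N → WeightFunction)
    (i : (ℕ × (Fin N → ℕ)) ⊕ (ℕ × (Fin N → ℕ))) :
    Space ω σ →ₗ[ℂ] (EuclideanSpace ℝ (Fin N) →ᵇ ℂ) where
  toFun φ := Sum.elim (fun r => φ.2.2.1.toBCF r.1 r.2) (fun r => φ.2.2.2.toBCF r.1 r.2) i
  map_add' φ χ := by
    rcases i with r | r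
    · exact φ.2.2.1.toBCF_add χ.2.2.1 (φ + χ).2.2.1 rfl _ _
    · exact φ.2.2.2.toBCF_add χ.2.2.2 (φ + χ).2.2.2 (fourierT_add φ.2.1 χ.2.1) _ _
  map_smul' c φ := by
    rcases i with r | r
    · exact φ.2.2.1.toBCF_smul c (c • φ).2.2.1 rfl _ _
    · exact φ.2.2.2.toBCF_smul c (c • φ).2.2.2 (fourierT_smul c φ.1) _ _

lemma norm_component (i : (ℕ × (Fin N → ℕ)) ⊕ (ℕ × (Fin N → ℕ))) (φ : Space ω σ) :
    ‖component ω σ i φ‖ = seminorms ω σ i φ := by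
  rcases i with r | r
  · exact φ.2.2.1.norm_toBCF _ _
  · exact φ.2.2.2.norm_toBCF _ _

lemma continuous_component (i : (ℕ × (Fin N → ℕ)) ⊕ (ℕ × (Fin N → ℕ))) :
    Continuous (component ω σ i) := by
  refine (withSeminorms ω σ).continuous_normedSpace_rng _ _ ⟨{i}, 1, fun φ => ?_⟩
  rw [Finset.sup_singleton, one_smul]
  exact (norm_component i φ).le

/-- A linear form dominated by the norm of `J` commutes with an integral that `J` maps to a Bochner
integral. -/
lemma map_eq_integral_of_le_norm {V B P : Type*} [AddCommGroup V] [Module ℂ V]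
    [NormedAddCommGroup B] [NormedSpace ℂ B] [CompleteSpace B] [MeasurableSpace P] {μ : Measure P}
    (J : V →ₗ[ℂ] B) (f : V →ₗ[ℂ] ℂ) (C : ℝ) (hf : ∀ v, ‖f v‖ ≤ C * ‖J v‖) {ψ : P → V}
    (hψ : Integrable (fun p => J (ψ p)) μ) {v : V} (hv : J v = ∫ p, J (ψ p) ∂μ) :
    f v = ∫ p, f (ψ p) ∂μ := by
  -- The bound makes `f` vanish on the kernel of `J`, so `f` factors through the range of `J` as a
  -- bounded form, which Hahn–Banach extends to all of `B`. No completeness of `V` is needed.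
  have hker : f ∈ J.ker.dualAnnihilator := by
    rw [Submodule.mem_dualAnnihilator]
    intro w hw
    have := hf w
    rw [LinearMap.mem_ker.1 hw, norm_zero, mul_zero] at this
    exact norm_le_zero_iff.1 this
  rw [← LinearMap.range_dualMap_eq_dualAnnihilator_ker] at hker
  obtain ⟨F, rfl⟩ := hker
  obtain ⟨G, hG, -⟩ := exists_extension_norm_eq (𝕜 := ℂ) J.range
    ((F.comp J.range.subtype).mkContinuous C (by
      rintro ⟨_, w, rfl⟩
      exact hf w))
  have hGJ : ∀ w, J.dualMap F w = G (J w) := fun w => (hG ⟨J w, w, rfl⟩).symm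
  simp only [hGJ]
  rw [hv, G.integral_comp_comm hψ]

/-- The growth bound on the family gives norm integrability. Point evaluations are continuous
functionals on bounded functions, so the Bochner integral is computed pointwise, where `D^α` already
passes under the integral. -/
lemma GoodFamily.toBCF_integral {P : Type*} [TopologicalSpace P] [MeasurableSpace P]
    [OpensMeasurableSpace P] {μ : Measure P} {W : P → ℝ} (hW0 : ∀ p, 0 ≤ W p)
    (hμ : ∃ M : ℝ, 0 < M ∧ Integrable (fun p => Real.exp (-M * W p)) μ) {b : P → ℂ}
    (hbc : Continuous b) (hb : RapidDecay W b) {ψ : P → EuclideanSpace ℝ (Fin N) → ℂ}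
    (h : GoodFamily (directSum ω) W ψ) (hs : ∀ p, WeightedSmooth (directSum ω) (ψ p))
    {k : EuclideanSpace ℝ (Fin N) → ℂ} (hk : WeightedSmooth (directSum ω) k)
    (hkψ : k = fun t => ∫ p, b p * ψ p t ∂μ) (n : ℕ) (α : Fin N → ℕ)
    (hm : AEStronglyMeasurable (fun p => b p • (hs p).toBCF n α) μ) :
    Integrable (fun p => b p • (hs p).toBCF n α) μ ∧
      hk.toBCF n α = ∫ p, b p • (hs p).toBCF n α ∂μ := by
  obtain ⟨C, m, hC, hbd⟩ := h.bound α ((n : ℝ) + 1) (by positivity)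
  obtain ⟨B, hB, hbB⟩ := hb.exists_integrable_bound hW0 hμ C m hC
  have hi : Integrable (fun p => b p • (hs p).toBCF n α) μ := by
    refine hB.mono' hm (Filter.Eventually.of_forall fun p => le_trans ?_ (hbB p))
    rw [norm_smul, WeightedSmooth.norm_toBCF]
    exact mul_le_mul_of_nonneg_left (ciSup_le (hbd p)) (norm_nonneg _)
  refine ⟨hi, ?_⟩
  ext t
  have h1 := (evalCLM ℂ t).integral_comp_comm hi
  simp only [evalCLM_apply] at h1
  rw [← h1, hk.toBCF_apply, hkψ, h.mderiv_integral hW0 hμ hbc hb, ← integral_const_mul]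
  congr 1
  funext p
  rw [BoundedContinuousFunction.smul_apply, WeightedSmooth.toBCF_apply, smul_eq_mul, mul_left_comm]

/-- Fubini's theorem, with the product `exp (-M Ω(t)) * B(p)` as integrable majorant. -/
lemma GoodFamily.fourierT_integral {P : Type*} [TopologicalSpace P] [SecondCountableTopology P]
    [MeasurableSpace P] [OpensMeasurableSpace P] {μ : Measure P} [SFinite μ] {W : P → ℝ}
    (hW0 : ∀ p, 0 ≤ W p)
    (hμ : ∃ M : ℝ, 0 < M ∧ Integrable (fun p => Real.exp (-M * W p)) μ) {b : P → ℂ}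
    (hbc : Continuous b) (hb : RapidDecay W b) {ψ : P → EuclideanSpace ℝ (Fin N) → ℂ}
    (h : GoodFamily (directSum ω) W ψ) :
    fourierT (fun t => ∫ p, b p * ψ p t ∂μ) = fun η => ∫ p, b p * fourierT (ψ p) η ∂μ := by
  funext η
  obtain ⟨M, hM, hiM⟩ := integrable_exp_neg_directSum ω
  obtain ⟨B, hB, hbB⟩ := h.exists_dominating hW0 hμ hb 0 M hM
  have hi : Integrable (Function.uncurry fun (t : EuclideanSpace ℝ (Fin N)) (p : P) =>
      Complex.exp (-(Complex.I * (inner ℝ t η : ℝ))) * (b p * ψ p t)) (volume.prod μ) := by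
    refine (hiM.mul_prod hB).mono' ?_ (Filter.Eventually.of_forall fun ⟨t, p⟩ => ?_)
    · have h1 := h.continuous 0
      simp only [mderiv_zero] at h1
      have h2 : Continuous fun z : EuclideanSpace ℝ (Fin N) × P => ψ z.2 z.1 :=
        h1.comp (continuous_snd.prodMk continuous_fst)
      have h3 : Continuous fun t : EuclideanSpace ℝ (Fin N) =>
          Complex.exp (-(Complex.I * (inner ℝ t η : ℝ))) := by fun_prop
      exact ((h3.comp continuous_fst).mul
        ((hbc.comp continuous_snd).mul h2)).aestronglyMeasurable
    · have h1 := exp_mul_le_iff.1 (hbB p t)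
      rw [mderiv_zero] at h1
      rw [Function.uncurry_apply_pair, norm_mul, norm_phase, one_mul, neg_mul]
      exact h1.trans_eq (mul_comm _ _)
  calc fourierT (fun t => ∫ p, b p * ψ p t ∂μ) η
      = ∫ t, ∫ p, Complex.exp (-(Complex.I * (inner ℝ t η : ℝ))) * (b p * ψ p t) ∂μ := by
        simp only [fourierT, integral_const_mul]
    _ = ∫ p, (∫ t, Complex.exp (-(Complex.I * (inner ℝ t η : ℝ))) * (b p * ψ p t)) ∂μ :=
        integral_integral_swap hi
    _ = _ := by
        congr 1
        funext p
        rw [fourierT, ← integral_const_mul]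
        congr 1
        funext t
        exact mul_left_comm _ _ _

/-- Superpositions of time-frequency shifts with rapidly decreasing coefficients converge in
`S_Ω^Σ`. -/
theorem exists_integral_conjShift (g : Space ω σ)
    {b : EuclideanSpace ℝ (Fin N) × EuclideanSpace ℝ (Fin N) → ℂ} (hbc : Continuous b)
    (hb : RapidDecay (phaseWeight ω σ) b) :
    ∃ H : Space ω σ, (∀ t, H t = ∫ p, b p * conjShift g p.1 p.2 t) ∧
      ∀ f : Ultradistribution ω σ, f H = ∫ p, b p * f (conjShift g p.1 p.2) := by
  have hW0 := phaseWeight_nonneg ω σ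
  have hμ := integrable_exp_neg_phaseWeight ω σ
  have hg1 := goodFamily_conjShift g
  have hg2 := goodFamily_fourierT_conjShift g
  have hs := hg1.weightedSmooth_integral hW0 hμ hbc hb
  have hF := hg1.fourierT_integral hW0 hμ hbc hb
  -- The superposition is defined pointwise. Its Fourier transform is the superposition of the
  -- transformed shifts, a good family for `Σ`, so both decay conditions come from the same lemma.
  let H : Space ω σ := ⟨fun t => ∫ p, b p * conjShift g p.1 p.2 t, hs.integrable, hs, by
    rw [hF]; exact hg2.weightedSmooth_integral hW0 hμ hbc hb⟩
  refine ⟨H, fun t => rfl, fun f => ?_⟩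
  have hcont : ∀ i, Continuous fun p : EuclideanSpace ℝ (Fin N) × EuclideanSpace ℝ (Fin N) =>
      b p • component ω σ i (conjShift g p.1 p.2) := fun i =>
    hbc.smul ((continuous_component i).comp (continuous_conjShift g))
  have hcomp : ∀ i, Integrable (fun p => component ω σ i (b p • conjShift g p.1 p.2)) ∧
      component ω σ i H = ∫ p, component ω σ i (b p • conjShift g p.1 p.2) := by
    intro i
    simp only [map_smul]
    rcases i with r | r
    · exact hg1.toBCF_integral hW0 hμ hbc hb (fun p => (conjShift g p.1 p.2).2.2.1) H.2.2.1 rfl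
        _ _ (hcont (Sum.inl r)).aestronglyMeasurable
    · exact hg2.toBCF_integral hW0 hμ hbc hb (fun p => (conjShift g p.1 p.2).2.2.2) H.2.2.2 hF
        _ _ (hcont (Sum.inr r)).aestronglyMeasurable
  -- Continuity bounds `f` by finitely many seminorms; their maximum is the norm of the map into the
  -- finite product of the spaces of bounded functions.
  obtain ⟨s, C, -, hC⟩ := Seminorm.bound_of_continuous (withSeminorms ω σ)
    ((normSeminorm ℂ ℂ).comp f.toLinearMap) (continuous_norm.comp f.continuous)
  have hle : ∀ φ : Space ω σ, ‖f.toLinearMap φ‖ ≤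
      C * ‖LinearMap.pi (fun i : s => component ω σ i) φ‖ := by
    intro φ
    refine (hC φ).trans ?_
    refine mul_le_mul_of_nonneg_left (Seminorm.finset_sup_apply_le (norm_nonneg _) fun i hi => ?_)
      C.coe_nonneg
    rw [← norm_component]
    exact norm_le_pi_norm (LinearMap.pi (fun i : s => component ω σ i) φ) ⟨i, hi⟩
  have key := map_eq_integral_of_le_norm (LinearMap.pi fun i : s => component ω σ i) f.toLinearMap
    C hle (ψ := fun p => b p • conjShift g p.1 p.2) (v := H) (μ := volume)
    (Integrable.of_eval fun i : s => (hcomp i).1)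
    (funext fun i : s =>
      (hcomp i).2.trans (eval_integral (fun i : s => (hcomp i).1) i).symm)
  simp only [map_smul, smul_eq_mul] at key
  exact key

end Beurling

/-! ### The reproducing formula and the characterization. -/

namespace Beurling

open MeasureTheory

variable {N : ℕ} {ω σ : Fin N → WeightFunction}

/-- The reflection `(x, ξ) ↦ (x, -ξ)` of phase space. -/
def reflectFreq (p : EuclideanSpace ℝ (Fin N) × EuclideanSpace ℝ (Fin N)) :
    EuclideanSpace ℝ (Fin N) × EuclideanSpace ℝ (Fin N) := (p.1, -p.2)

lemma reflectFreq_reflectFreq (p : EuclideanSpace ℝ (Fin N) × EuclideanSpace ℝ (Fin N)) :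
    reflectFreq (reflectFreq p) = p :=
  Prod.ext rfl (neg_neg _)

lemma continuous_reflectFreq : Continuous (reflectFreq (N := N)) :=
  continuous_fst.prodMk continuous_snd.neg

lemma integral_comp_reflectFreq
    (F : EuclideanSpace ℝ (Fin N) × EuclideanSpace ℝ (Fin N) → ℂ) :
    ∫ p, F (reflectFreq p) = ∫ p, F p :=
  ((MeasurePreserving.id volume).prod (Measure.measurePreserving_neg volume)).integral_comp
    ((Homeomorph.refl _).prodCongr (Homeomorph.neg _)).measurableEmbedding F

lemma RapidDecay.comp_reflectFreq
    {b : EuclideanSpace ℝ (Fin N) × EuclideanSpace ℝ (Fin N) → ℂ}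
    (hb : RapidDecay (phaseWeight ω σ) b) :
    RapidDecay (phaseWeight ω σ) (fun p => b (reflectFreq p)) := by
  intro l hl
  obtain ⟨C, hC, h⟩ := hb l hl
  refine ⟨C, hC, fun p => (h _).trans_eq ?_⟩
  simp [phaseWeight, reflectFreq, directSum_neg]

lemma continuous_integral_mul_conjShift (φ g : Space ω σ) :
    Continuous fun p : EuclideanSpace ℝ (Fin N) × EuclideanSpace ℝ (Fin N) =>
      ∫ t, φ t * conjShift g p.1 p.2 t :=
  φ.toUltradistribution.continuous.comp (continuous_conjShift g)

lemma conjShift_apply (g : Space ω σ) (x ξ t : EuclideanSpace ℝ (Fin N)) :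
    conjShift g x ξ t =
      Complex.exp (-(Complex.I * (inner ℝ t ξ : ℝ))) * (starRingEnd ℂ) (g (t - x)) := rfl

lemma conjShift_conj_apply (g : Space ω σ) (x ξ t : EuclideanSpace ℝ (Fin N)) :
    conjShift g.conj x ξ t = Complex.exp (-(Complex.I * (inner ℝ t ξ : ℝ))) * g (t - x) :=
  congrArg (_ * ·) (Complex.conj_conj _)

lemma integral_mul_conjShift_conj (φ g : Space ω σ) (x ξ : EuclideanSpace ℝ (Fin N)) :
    ∫ t, φ t * conjShift g.conj x ξ t = fourierT (fun t => φ t * g (t - x)) ξ := by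
  simp only [conjShift_conj_apply, mul_left_comm, fourierT]

/-- For fixed `x` this transform is the correlation of `φ` with the shifts of `ḡ`, whose decay in
`Σ(ξ)` is known. It justifies Fourier inversion for `φ · g(· - x)`. -/
lemma integrable_fourierT_mul_translate (φ g : Space ω σ) (x : EuclideanSpace ℝ (Fin N)) :
    Integrable (fourierT fun t => φ t * g (t - x)) := by
  obtain ⟨u, hu⟩ : ∃ u, u = fourierT fun t => φ t * g (t - x) := ⟨_, rfl⟩
  obtain ⟨A, hA⟩ : ∃ A : EuclideanSpace ℝ (Fin N) × EuclideanSpace ℝ (Fin N) → ℂ,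
      A = fun p => ∫ t, φ t * conjShift g.conj p.1 p.2 t := ⟨_, rfl⟩
  have hAc : Continuous A := hA ▸ continuous_integral_mul_conjShift φ g.conj
  have hAd : RapidDecay (phaseWeight ω σ) A := hA ▸ rapidDecay_integral_mul_conjShift φ g.conj
  have h0 : ∀ ξ, u ξ = A (x, ξ) := fun ξ => by
    rw [hu, hA, ← integral_mul_conjShift_conj]
  have hc : Continuous u := by
    rw [funext h0]
    exact hAc.comp (Continuous.prodMk_right x)
  rw [← hu]
  refine integrable_of_decay (ω := σ) hc fun l hl => ?_
  obtain ⟨C, hC, h⟩ := hAd l hl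
  refine ⟨C, fun ξ => exp_mul_le_iff.2 ?_⟩
  rw [h0]
  refine (h (x, ξ)).trans (mul_le_mul_of_nonneg_left (Real.exp_le_exp.2 ?_) hC)
  have := mul_nonneg hl.le (directSum_nonneg ω x)
  simp only [phaseWeight]
  linarith

/-- The reproducing formula of the short-time Fourier transform. -/
lemma integral_stft_mul_conjShift (φ g : Space ω σ) (t : EuclideanSpace ℝ (Fin N)) :
    ∫ p : EuclideanSpace ℝ (Fin N) × EuclideanSpace ℝ (Fin N),
      (∫ s, φ s * conjShift g.conj (reflectFreq p).1 (reflectFreq p).2 s) *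
        conjShift g p.1 p.2 t =
      (2 * Real.pi : ℂ) ^ N * (∫ s, g s * (starRingEnd ℂ) (g s)) * φ t := by
  have hA := rapidDecay_integral_mul_conjShift φ g.conj
  have hAc := continuous_integral_mul_conjShift φ g.conj
  obtain ⟨B, hB, hbB⟩ := (goodFamily_conjShift g).exists_dominating_zero (phaseWeight_nonneg ω σ)
    (integrable_exp_neg_phaseWeight ω σ) hA.comp_reflectFreq
  have hi : Integrable (fun p : EuclideanSpace ℝ (Fin N) × EuclideanSpace ℝ (Fin N) =>
      (∫ s, φ s * conjShift g.conj (reflectFreq p).1 (reflectFreq p).2 s) *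
        conjShift g p.1 p.2 t) :=
    hB.mono' ((hAc.comp continuous_reflectFreq).mul
      ((goodFamily_conjShift g).continuous_apply t)).aestronglyMeasurable
      (Filter.Eventually.of_forall fun p => hbB p t)
  rw [Measure.volume_eq_prod] at hi ⊢
  rw [integral_prod _ hi]
  -- For fixed `x`, the integral over frequencies is Fourier inversion at `t` for the function `φ ·
  -- g(· - x)`; the factor `conj (g (t - x))` does not depend on `ξ`.
  have inner_integral : ∀ x, ∫ ξ, (∫ s, φ s * conjShift g.conj x (-ξ) s) * conjShift g x ξ t =
      (2 * Real.pi : ℂ) ^ N * φ t * (g (t - x) * (starRingEnd ℂ) (g (t - x))) := by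
    intro x
    have hc : Continuous fun t => φ t * g (t - x) :=
      φ.continuous.mul (g.continuous.comp (continuous_id.sub continuous_const))
    have hint : Integrable fun t => φ t * g (t - x) := by
      have h1 := φ.integrable_mul (conjShift g.conj x 0)
      simpa [conjShift_conj_apply] using h1
    rw [← integral_neg_eq_self]
    calc ∫ ξ, (∫ s, φ s * conjShift g.conj x (- -ξ) s) * conjShift g x (-ξ) t
        = ∫ ξ, (Complex.exp (Complex.I * (inner ℝ ξ t : ℝ)) *
            fourierT (fun t => φ t * g (t - x)) ξ) * (starRingEnd ℂ) (g (t - x)) := by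
          congr 1
          funext ξ
          rw [neg_neg, integral_mul_conjShift_conj, conjShift_apply, inner_neg_right, real_inner_comm]
          push_cast
          rw [mul_neg, neg_neg]
          ring
      _ = _ := by
          rw [integral_mul_const, integral_exp_mul_fourierT hc hint (integrable_fourierT_mul_translate φ g x)]
          ring
  refine (integral_congr_ae (Filter.Eventually.of_forall inner_integral)).trans ?_
  -- The substitution `s = t - x` turns the remaining integral into the squared `L²` norm of `g`,
  -- independent of `t`.
  rw [integral_const_mul, integral_sub_left_eq_self (fun s => g s * (starRingEnd ℂ) (g s)) volume t]
  ring

lemma integral_mul_conj_ne_zero {g : Space ω σ} (hg : g ≠ 0) :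
    ∫ s, g s * (starRingEnd ℂ) (g s) ≠ 0 := by
  have h1 : (fun s => g s * (starRingEnd ℂ) (g s)) = fun s => ((‖g s‖ ^ 2 : ℝ) : ℂ) := by
    funext s
    rw [Complex.mul_conj, Complex.normSq_eq_norm_sq]
  have hc : Continuous fun s => ‖g s‖ ^ 2 := g.continuous.norm.pow 2
  have hi : Integrable fun s => ‖g s‖ ^ 2 := by
    have := (g.integrable_mul g.conj).norm
    refine this.congr (Filter.Eventually.of_forall fun s => ?_)
    change ‖g s * (starRingEnd ℂ) (g s)‖ = ‖g s‖ ^ 2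
    rw [norm_mul, RCLike.norm_conj, sq]
  obtain ⟨s, hs⟩ : ∃ s, g s ≠ 0 := by
    by_contra! h
    exact hg (Space.ext h)
  rw [h1, integral_complex_ofReal, Complex.ofReal_ne_zero]
  exact (integral_pos_of_integrable_nonneg_nonzero hc hi (fun s => sq_nonneg _)
    (pow_ne_zero 2 (norm_ne_zero_iff.2 hs))).ne'

/-- An ultradistribution whose short-time Fourier transform decreases rapidly is a function. -/
theorem belongsToSpace_of_rapidDecay {g : Space ω σ} (hg : g ≠ 0) (f : Ultradistribution ω σ)
    (hf : RapidDecay (phaseWeight ω σ) (fun p => stft g f p.1 p.2)) : f.BelongsToSpace := by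
  have hfc : Continuous fun p : EuclideanSpace ℝ (Fin N) × EuclideanSpace ℝ (Fin N) =>
      stft g f p.1 p.2 := f.continuous.comp (continuous_conjShift g)
  -- The candidate is `h = ∫ V_g f(x, -ξ) conjShift ḡ x ξ`, which represents `f` up to the constant
  -- `k`.
  obtain ⟨h, -, hh⟩ := exists_integral_conjShift g.conj (hfc.comp continuous_reflectFreq)
    hf.comp_reflectFreq
  obtain ⟨k, hk⟩ : ∃ k : ℂ, k = (2 * Real.pi : ℂ) ^ N * ∫ s, g s * (starRingEnd ℂ) (g s) :=
    ⟨_, rfl⟩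
  have hk0 : k ≠ 0 := hk ▸ mul_ne_zero (pow_ne_zero _ (by simp [Real.pi_ne_zero]))
    (integral_mul_conj_ne_zero hg)
  refine ⟨k⁻¹ • h, fun φ => ?_⟩
  -- The right-hand side of the reproducing formula for `φ`, as an element `H` of the space on which
  -- `f` can be evaluated under the integral.
  obtain ⟨H, hH, hfH⟩ := exists_integral_conjShift g
    ((continuous_integral_mul_conjShift φ g.conj).comp continuous_reflectFreq)
    (rapidDecay_integral_mul_conjShift φ g.conj).comp_reflectFreq
  have hHφ : H = k • φ := Space.ext fun t => by
    rw [hH, hk]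
    exact integral_stft_mul_conjShift φ g t
  have h1 := hfH f
  rw [hHφ, map_smul, smul_eq_mul] at h1
  -- The second interchange regards `φ` as an ultradistribution acting on `h`; reflecting the
  -- frequency matches it with the expansion of `f H`.
  have h2 : ∫ t, φ t * h t = k * f φ := by
    rw [h1, ← integral_comp_reflectFreq]
    refine (hh φ.toUltradistribution).trans (congrArg _ (funext fun p => ?_))
    simp only [Function.comp_apply, reflectFreq_reflectFreq]
    exact mul_comm _ _
  rw [← mul_right_inj' hk0, ← h2, ← integral_const_mul]
  congr 1
  funext t
  change _ = k * ((k⁻¹ * h t) * φ t)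
  rw [mul_comm (φ t), mul_assoc, mul_inv_cancel_left₀ hk0]

end Beurling

theorem mainTheorem5 (N : ℕ) (ω σ : Fin N → Beurling.WeightFunction)
    (g : Beurling.Space ω σ) (hg : g ≠ 0) (f : Beurling.Ultradistribution ω σ) :
    f.BelongsToSpace ↔
      ∀ l : ℝ, 0 < l → ∃ C : ℝ, 0 < C ∧ ∀ x ξ : EuclideanSpace ℝ (Fin N),
        ‖Beurling.stft g f x ξ‖ ≤
          C * Real.exp (-l * (Beurling.directSum ω x + Beurling.directSum σ ξ)) := by
  constructor
  · rintro ⟨h, hh⟩ l hl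
    obtain ⟨C, hC, hb⟩ := Beurling.rapidDecay_integral_mul_conjShift h g l hl
    -- The decay lemma only provides `0 ≤ C`, whereas a positive constant is required.
    refine ⟨C + 1, by positivity, fun x ξ => ?_⟩
    rw [Beurling.stft, hh]
    refine (hb (x, ξ)).trans ?_
    exact mul_le_mul_of_nonneg_right (by linarith) (Real.exp_pos _).le
  · intro H
    refine Beurling.belongsToSpace_of_rapidDecay hg f fun l hl => ?_
    obtain ⟨C, hC, hb⟩ := H l hl
    exact ⟨C, hC.le, fun p => hb p.1 p.2⟩
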